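/- Let $d\ge 3$ be an odd integer, let $X=\{1,\dots,d\}$, and let $T$ be the $d$-regular rooted tree whose vertices are the words in $X^*$, where the root is the empty word and the children of $u$ are the words $ux$, $x\in X$. For a root-preserving automorphism $g$ of $T$ and $x\in X$, let $g|_x$ be the automorphism of $T$ with $g(xv)=g(x)\,g|_x(v)$ for all $v\in X^*$. Let $G_d\le \mathrm{Aut}(T)$ be the group generated by the automorphisms $a_1,\dots,a_d$ defined recursively as follows (indices modulo $d$): $a_i$ acts on $X$ as the transposition $(i\ \ i{+}1)$, $a_i|_i=a_i$, $a_i|_{i+1}=a_{i+1}$, and $a_i|_x=e$ for $x\ne i,i+1$. For $k\ge 1$ let $\mathrm{St}(k)$ be the subgroup of the elements of $G_d$ that fix every vertex in $X^k$. For a vertex $u$ let $\mathrm{Rist}(u)$ be the subgroup of the elements of $G_d$ that fix every vertex not of the form $uv$, $v\in X^*$, and let $\mathrm{Rist}(k)$ be the subgroup generated by all $\mathrm{Rist}(u)$ with $u\in X^k$; it is a normal subgroup of $\mathrm{St}(k)$. Then for every $k\ge 1$ $$\mathrm{St}(k)/\mathrm{Rist}(k)\;\cong\;\prod_{i=1}^{d^k-1}\mathbb{Z}/\alpha_i\mathbb{Z},$$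 where $\alpha_i=2^{k+1}$ if $d\nmid i$, and $\alpha_i=2^{k-s}$ if $i=d^s r$ with $s\ge 1$ and $d\nmid r$. Moreover, the number $$t=\frac{(k+1)d^{k+1}-(k+3)d^k+d^{k-1}+1}{d-1}$$ is a non-negative integer, and $[\mathrm{St}(k):\mathrm{Rist}(k)]=2^t$. -/

import Mathlib

namespace GdGroup

/-- The `d`-regular rooted tree: vertices are the words over the alphabet `Fin d`, the root is the
empty word, and the children of `u` are the words `u ++ [x]`. -/
def regTree (d : ℕ) : SimpleGraph (List (Fin d)) where
  Adj u v := (∃ x, v = u ++ [x]) ∨ (∃ x, u = v ++ [x])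
  symm := ⟨fun _ _ h => h.symm⟩
  loopless := ⟨fun u h => by
    rcases h with ⟨x, h⟩ | ⟨x, h⟩ <;> simp at h⟩

/-- `Aut(T)`: the group of the graph automorphisms of the rooted tree that preserve the root. -/
def autTree (d : ℕ) : Subgroup (Equiv.Perm (List (Fin d))) where
  carrier := {g | g [] = [] ∧ ∀ u v, (regTree d).Adj (g u) (g v) ↔ (regTree d).Adj u v}
  one_mem' := ⟨rfl, fun _ _ => Iff.rfl⟩
  mul_mem' := by
    rintro a b ⟨ha, ha'⟩ ⟨hb, hb'⟩
    refine ⟨?_, fun u v => ?_⟩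
    · rw [Equiv.Perm.mul_apply, hb, ha]
    · rw [Equiv.Perm.mul_apply, Equiv.Perm.mul_apply, ha', hb']
  inv_mem' := by
    rintro a ⟨ha, ha'⟩
    refine ⟨?_, fun u v => ?_⟩
    · rw [Equiv.Perm.inv_eq_iff_eq, ha]
    · simpa using (ha' (a⁻¹ u) (a⁻¹ v)).symm

/-- The cyclic successor `i ↦ i + 1` modulo `d`. -/
def next (d : ℕ) (i : Fin d) : Fin d := finRotate d i

/-- The action on words of the automorphism `a_i` with wreath recursion
`a_i = (e, …, e, a_i, a_{i+1}, e, …, e) (i  i+1)`, the entries `a_i` and `a_{i+1}` standing at the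
positions `i` and `i+1`. -/
def genFun (d : ℕ) : Fin d → List (Fin d) → List (Fin d)
  | _, [] => []
  | i, x :: v =>
    if x = i then next d i :: genFun d i v
    else if x = next d i then i :: genFun d (next d i) v
    else x :: v

/-- The inverse of `genFun d i`. -/
def genInv (d : ℕ) : Fin d → List (Fin d) → List (Fin d)
  | _, [] => []
  | i, x :: v =>
    if x = next d i then i :: genInv d i v
    else if x = i then next d i :: genInv d (next d i) v
    else x :: v

theorem genInv_genFun (d : ℕ) (i : Fin d) (u : List (Fin d)) :
    genInv d i (genFun d i u) = u := by
  induction u generalizing i with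
  | nil => rfl
  | cons x v ih =>
    by_cases h1 : x = i
    · subst h1
      simp [genFun, genInv, ih]
    · by_cases h2 : x = next d i
      · by_cases h3 : i = next d i
        · exact absurd (h2.trans h3.symm) h1
        · have h4 : next d i ≠ i := fun h => h3 h.symm
          subst h2
          simp [genFun, genInv, ih, h4, h3]
      · simp [genFun, genInv, h1, h2]

theorem genFun_genInv (d : ℕ) (i : Fin d) (u : List (Fin d)) :
    genFun d i (genInv d i u) = u := by
  induction u generalizing i with
  | nil => rfl
  | cons x v ih =>
    by_cases h2 : x = next d i
    · subst h2
      simp [genFun, genInv, ih]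
    · by_cases h1 : x = i
      · subst h1
        have h3 : next d x ≠ x := fun h => h2 h.symm
        simp [genFun, genInv, ih, h2, h3]
      · simp [genFun, genInv, h1, h2]

/-- The generator `a_i`. -/
def gen (d : ℕ) (i : Fin d) : Equiv.Perm (List (Fin d)) where
  toFun := genFun d i
  invFun := genInv d i
  left_inv := genInv_genFun d i
  right_inv := genFun_genInv d i

/-- The group `G_d`, generated by `a_1, …, a_d`. -/
def G (d : ℕ) : Subgroup (Equiv.Perm (List (Fin d))) :=
  Subgroup.closure (Set.range (gen d))

/-- The `k`-th level stabilizer `St_H(k)`: the elements of `H` that fix every vertex at level `k`. -/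
def levelStab {d : ℕ} (H : Subgroup (Equiv.Perm (List (Fin d)))) (k : ℕ) :
    Subgroup (Equiv.Perm (List (Fin d))) where
  carrier := {g | g ∈ H ∧ ∀ u : List (Fin d), u.length = k → g u = u}
  one_mem' := ⟨H.one_mem, fun _ _ => rfl⟩
  mul_mem' := by
    rintro a b ⟨ha, ha'⟩ ⟨hb, hb'⟩
    refine ⟨H.mul_mem ha hb, fun u hu => ?_⟩
    rw [Equiv.Perm.mul_apply, hb' u hu, ha' u hu]
  inv_mem' := by
    rintro a ⟨ha, ha'⟩
    refine ⟨H.inv_mem ha, fun u hu => ?_⟩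
    rw [Equiv.Perm.inv_eq_iff_eq, ha' u hu]

/-- The rigid stabilizer `Rist_H(u)` of the vertex `u`: the elements of `H` that fix every vertex
outside the subtree `{uv}` rooted at `u`. -/
def rist {d : ℕ} (H : Subgroup (Equiv.Perm (List (Fin d)))) (u : List (Fin d)) :
    Subgroup (Equiv.Perm (List (Fin d))) where
  carrier := {g | g ∈ H ∧ ∀ w : List (Fin d), ¬ u <+: w → g w = w}
  one_mem' := ⟨H.one_mem, fun _ _ => rfl⟩
  mul_mem' := by
    rintro a b ⟨ha, ha'⟩ ⟨hb, hb'⟩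
    refine ⟨H.mul_mem ha hb, fun u hu => ?_⟩
    rw [Equiv.Perm.mul_apply, hb' u hu, ha' u hu]
  inv_mem' := by
    rintro a ⟨ha, ha'⟩
    refine ⟨H.inv_mem ha, fun u hu => ?_⟩
    rw [Equiv.Perm.inv_eq_iff_eq, ha' u hu]

/-- The `k`-th level rigid stabilizer `Rist_H(k)`: the subgroup generated by the rigid stabilizers
of the vertices at level `k`. -/
def levelRist {d : ℕ} (H : Subgroup (Equiv.Perm (List (Fin d)))) (k : ℕ) :
    Subgroup (Equiv.Perm (List (Fin d))) :=
  Subgroup.closure {g | ∃ u : List (Fin d), u.length = k ∧ g ∈ rist H u}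

/-- `α_i = 2^(k+1)` if `d ∤ i`, and `α_i = 2^(k-s)` if `i = d^s r` with `s ≥ 1` and `d ∤ r`;
`multiplicity d i` is the exponent `s` (for `d ≥ 2` and `i ≥ 1`). -/
noncomputable def alpha (d k i : ℕ) : ℕ :=
  if d ∣ i then 2 ^ (k - multiplicity d i) else 2 ^ (k + 1)

/-! ### Facts needed for the quotient to be a group, and sanity checks -/

theorem alpha_eq_of_not_dvd {d k i : ℕ} (h : ¬ d ∣ i) : alpha d k i = 2 ^ (k + 1) := by
  simp [alpha, h]

theorem alpha_eq_of_eq {d k s r : ℕ} (hd : 2 ≤ d) (hs : 1 ≤ s) (hr : ¬ d ∣ r) :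
    alpha d k (d ^ s * r) = 2 ^ (k - s) := by
  have h1 : multiplicity d (d ^ s * r) = s := by
    apply multiplicity_eq_of_dvd_of_not_dvd (dvd_mul_right _ _)
    rw [pow_succ]
    intro h
    exact hr (Nat.dvd_of_mul_dvd_mul_left (by positivity) h)
  have h2 : d ∣ d ^ s * r := Dvd.dvd.mul_right (dvd_pow_self d (by omega)) r
  rw [alpha, if_pos h2, h1]

/-- A root-preserving automorphism maps children of `u` to children of `g u`. -/
theorem autTree_child {d : ℕ} {g : Equiv.Perm (List (Fin d))} (hg : g ∈ autTree d)
    (u : List (Fin d)) (x : Fin d) : ∃ y, g (u ++ [x]) = g u ++ [y] := by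
  induction u using List.reverseRecOn generalizing x with
  | nil =>
    have h : (regTree d).Adj (g []) (g ([] ++ [x])) := (hg.2 _ _).2 (Or.inl ⟨x, rfl⟩)
    rcases h with h | ⟨y, h⟩
    · exact h
    · rw [hg.1] at h
      simp at h
  | append_singleton u z ih =>
    have h : (regTree d).Adj (g (u ++ [z])) (g ((u ++ [z]) ++ [x])) :=
      (hg.2 _ _).2 (Or.inl ⟨x, rfl⟩)
    rcases h with h | ⟨y, h⟩
    · exact h
    · obtain ⟨y', h'⟩ := ih z
      rw [h'] at h
      have h2 := g.injective (List.append_inj' h rfl).1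
      have h3 := congrArg List.length h2
      simp at h3

theorem autTree_length {d : ℕ} {g : Equiv.Perm (List (Fin d))} (hg : g ∈ autTree d)
    (u : List (Fin d)) : (g u).length = u.length := by
  induction u using List.reverseRecOn with
  | nil => rw [hg.1]
  | append_singleton u z ih =>
    obtain ⟨y, h⟩ := autTree_child hg u z
    rw [h]
    simp [ih]

theorem autTree_prefix {d : ℕ} {g : Equiv.Perm (List (Fin d))} (hg : g ∈ autTree d)
    (u w : List (Fin d)) (h : u <+: w) : g u <+: g w := by
  obtain ⟨t, rfl⟩ := h
  induction t using List.reverseRecOn with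
  | nil => simp
  | append_singleton t z ih =>
    obtain ⟨y, h⟩ := autTree_child hg (u ++ t) z
    rw [← List.append_assoc, h]
    exact ih.trans (List.prefix_append _ _)

theorem genFun_child (d : ℕ) (i : Fin d) (u : List (Fin d)) (x : Fin d) :
    ∃ y, genFun d i (u ++ [x]) = genFun d i u ++ [y] := by
  induction u generalizing i with
  | nil =>
    simp only [List.nil_append, genFun]
    split_ifs <;> simp
  | cons z u ih =>
    simp only [List.cons_append, genFun]
    split_ifs
    · obtain ⟨y, h⟩ := ih i
      exact ⟨y, by rw [h, List.cons_append]⟩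
    · obtain ⟨y, h⟩ := ih (next d i)
      exact ⟨y, by rw [h, List.cons_append]⟩
    · exact ⟨x, rfl⟩

theorem genInv_child (d : ℕ) (i : Fin d) (u : List (Fin d)) (x : Fin d) :
    ∃ y, genInv d i (u ++ [x]) = genInv d i u ++ [y] := by
  induction u generalizing i with
  | nil =>
    simp only [List.nil_append, genInv]
    split_ifs <;> simp
  | cons z u ih =>
    simp only [List.cons_append, genInv]
    split_ifs
    · obtain ⟨y, h⟩ := ih i
      exact ⟨y, by rw [h, List.cons_append]⟩
    · obtain ⟨y, h⟩ := ih (next d i)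
      exact ⟨y, by rw [h, List.cons_append]⟩
    · exact ⟨x, rfl⟩

/-- The generators are automorphisms of the rooted tree. -/
theorem gen_mem_autTree (d : ℕ) (i : Fin d) : gen d i ∈ autTree d := by
  refine ⟨rfl, fun u v => ⟨?_, ?_⟩⟩
  · have key : ∀ a b : List (Fin d), (∃ x, gen d i b = gen d i a ++ [x]) → ∃ x, b = a ++ [x] := by
      rintro a b ⟨x, h⟩
      obtain ⟨y, hy⟩ := genInv_child d i (genFun d i a) x
      refine ⟨y, ?_⟩
      have h' : genFun d i b = genFun d i a ++ [x] := h
      rw [← h', genInv_genFun, genInv_genFun] at hy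
      exact hy
    rintro (h | h)
    · exact Or.inl (key u v h)
    · exact Or.inr (key v u h)
  · rintro (⟨x, rfl⟩ | ⟨x, rfl⟩)
    · exact Or.inl (genFun_child d i u x)
    · exact Or.inr (genFun_child d i v x)

/-- `G_d` is a subgroup of `Aut(T)`. -/
theorem G_le_autTree (d : ℕ) : G d ≤ autTree d := by
  rw [G, Subgroup.closure_le]
  rintro _ ⟨i, rfl⟩
  exact gen_mem_autTree d i

/-- For a group of tree automorphisms, `Rist_H(k)` is contained in `St_H(k)`. -/
theorem levelRist_le_levelStab {d : ℕ} {H : Subgroup (Equiv.Perm (List (Fin d)))}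
    (hH : H ≤ autTree d) (k : ℕ) : levelRist H k ≤ levelStab H k := by
  rw [levelRist, Subgroup.closure_le]
  rintro g ⟨u, hu, hg, hg'⟩
  have other : ∀ v : List (Fin d), v.length = k → v ≠ u → g v = v := fun v hv hne =>
    hg' v fun h => hne (h.eq_of_length (hu.trans hv.symm)).symm
  refine ⟨hg, fun v hv => ?_⟩
  by_cases hvu : v = u
  · by_contra hne
    have hl : (g v).length = k := (autTree_length (hH hg) v).trans hv
    exact hne (g.injective (other (g v) hl (fun h => hne (h.trans hvu.symm))))
  · exact other v hv hvu

/-- For a group of tree automorphisms, `Rist_H(k)` is normalized by `H`. -/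
theorem conj_mem_levelRist {d : ℕ} {H : Subgroup (Equiv.Perm (List (Fin d)))}
    (hH : H ≤ autTree d) (k : ℕ) {h g : Equiv.Perm (List (Fin d))} (hh : h ∈ H)
    (hg : g ∈ levelRist H k) : h * g * h⁻¹ ∈ levelRist H k := by
  induction hg using Subgroup.closure_induction with
  | mem g hg =>
    obtain ⟨u, hu, hgH, hg'⟩ := hg
    refine Subgroup.subset_closure ⟨h u, (autTree_length (hH hh) u).trans hu,
      H.mul_mem (H.mul_mem hh hgH) (H.inv_mem hh), fun w hw => ?_⟩
    have h1 : ¬ u <+: h⁻¹ w := fun hp => hw (by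
      simpa using autTree_prefix (hH hh) _ _ hp)
    rw [Equiv.Perm.mul_apply, Equiv.Perm.mul_apply, hg' _ h1]
    simp
  | one => simp
  | mul a b _ _ iha ihb =>
    have : h * (a * b) * h⁻¹ = (h * a * h⁻¹) * (h * b * h⁻¹) := by group
    rw [this]
    exact Subgroup.mul_mem _ iha ihb
  | inv a _ iha =>
    have : h * a⁻¹ * h⁻¹ = (h * a * h⁻¹)⁻¹ := by group
    rw [this]
    exact Subgroup.inv_mem _ iha

instance levelRist_normal (d k : ℕ) :
    ((levelRist (G d) k).subgroupOf (levelStab (G d) k)).Normal where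
  conj_mem := fun g hg h => by
    rw [Subgroup.mem_subgroupOf] at hg ⊢
    exact conj_mem_levelRist (G_le_autTree d) k h.2.1 hg

end GdGroup

namespace GdGroup

open Equiv Finset

variable {d : ℕ}

/-- The permutation of words acting on the first letter by `σ` and on the words that start with `x`
by `f x` after the first letter. -/
def node (σ : Perm (Fin d)) (f : Fin d → Perm (List (Fin d))) : Perm (List (Fin d)) where
  toFun
    | [] => []
    | x :: v => σ x :: f x v
  invFun
    | [] => []
    | x :: v => σ⁻¹ x :: (f (σ⁻¹ x))⁻¹ v
  left_inv u := by cases u <;> simp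
  right_inv u := by cases u <;> simp

@[simp] theorem node_nil (σ : Perm (Fin d)) (f : Fin d → Perm (List (Fin d))) :
    node σ f [] = [] := rfl

@[simp] theorem node_cons (σ : Perm (Fin d)) (f : Fin d → Perm (List (Fin d))) (x : Fin d)
    (v : List (Fin d)) : node σ f (x :: v) = σ x :: f x v := rfl

theorem node_mul (σ τ : Perm (Fin d)) (f h : Fin d → Perm (List (Fin d))) :
    node σ f * node τ h = node (σ * τ) fun x => f (τ x) * h x := by
  ext1 u
  cases u <;> simp [Perm.mul_apply]

theorem node_one : node (1 : Perm (Fin d)) (fun _ => 1) = 1 := by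
  ext1 u
  cases u <;> simp

theorem node_inv (σ : Perm (Fin d)) (f : Fin d → Perm (List (Fin d))) :
    (node σ f)⁻¹ = node σ⁻¹ fun x => (f (σ⁻¹ x))⁻¹ := by
  rw [inv_eq_iff_mul_eq_one, node_mul]
  simp [node_one]

theorem node_injective {σ τ : Perm (Fin d)} {f h : Fin d → Perm (List (Fin d))}
    (e : node σ f = node τ h) : σ = τ ∧ f = h := by
  have key : ∀ x v, σ x = τ x ∧ f x v = h x v := fun x v => by
    have := congrArg (fun g : Perm (List (Fin d)) => g (x :: v)) e
    simpa using this
  exact ⟨Equiv.ext fun x => (key x []).1, funext fun x => Equiv.ext fun v => (key x v).2⟩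

open Classical in
/-- The action on the first level (trivial if `g` is not of the form `node σ f`). -/
noncomputable def root (g : Perm (List (Fin d))) : Perm (Fin d) :=
  if h : ∃ σ f, g = node σ f then h.choose else 1

open Classical in
/-- The section at a vertex of the first level (trivial if `g` is not of the form `node σ f`). -/
noncomputable def sec1 (g : Perm (List (Fin d))) : Fin d → Perm (List (Fin d)) :=
  if h : ∃ σ f, g = node σ f then h.choose_spec.choose else fun _ => 1

theorem root_node_sec1_node (σ : Perm (Fin d)) (f : Fin d → Perm (List (Fin d))) :
    root (node σ f) = σ ∧ sec1 (node σ f) = f := by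
  have h : ∃ σ' f', node σ f = node σ' f' := ⟨σ, f, rfl⟩
  rw [root, sec1, dif_pos h, dif_pos h]
  have := node_injective h.choose_spec.choose_spec
  exact ⟨this.1.symm, this.2.symm⟩

@[simp] theorem root_node (σ : Perm (Fin d)) (f : Fin d → Perm (List (Fin d))) :
    root (node σ f) = σ := (root_node_sec1_node σ f).1

@[simp] theorem sec1_node (σ : Perm (Fin d)) (f : Fin d → Perm (List (Fin d))) :
    sec1 (node σ f) = f := (root_node_sec1_node σ f).2

/-! ### The cyclic successor -/

theorem next_val (x : Fin d) : (next d x).val = (x.val + 1) % d := by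
  obtain _ | n := d
  · exact x.elim0
  · rw [next, finRotate_apply, Fin.val_add, Fin.val_one']
    simp

theorem next_iterate_val (x : Fin d) (j : ℕ) : ((next d)^[j] x).val = (x.val + j) % d := by
  induction j with
  | zero => simp [Nat.mod_eq_of_lt x.2]
  | succ j ih => rw [Function.iterate_succ_apply', next_val, ih, Nat.mod_add_mod, add_assoc]

theorem next_iterate_eq_self {x : Fin d} {j : ℕ} : (next d)^[j] x = x ↔ d ∣ j := by
  rw [Fin.ext_iff, next_iterate_val]
  constructor
  · intro h
    have h2 : x.val + j ≡ x.val + 0 [MOD d] := by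
      rw [Nat.ModEq, h, add_zero, Nat.mod_eq_of_lt x.2]
    exact (Nat.modEq_zero_iff_dvd).1 (Nat.ModEq.add_left_cancel' _ h2)
  · rintro ⟨c, rfl⟩
    simp [Nat.mod_eq_of_lt x.2]

theorem next_ne (hd : 3 ≤ d) (x : Fin d) : next d x ≠ x := fun h => by
  have := Nat.le_of_dvd one_pos (next_iterate_eq_self.1 (show (next d)^[1] x = x from h))
  omega

theorem next_next_ne (hd : 3 ≤ d) (x : Fin d) : next d (next d x) ≠ x := fun h => by
  have := Nat.le_of_dvd two_pos (next_iterate_eq_self.1 (show (next d)^[2] x = x from h))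
  omega

theorem exists_next_iterate (x y : Fin d) : ∃ j, (next d)^[j] x = y :=
  ⟨d - x.val + y.val, by
    rw [Fin.ext_iff, next_iterate_val, ← add_assoc, Nat.add_sub_cancel' x.2.le]
    simp [Nat.mod_eq_of_lt y.2]⟩

theorem exists_next_iterate_two_mul (hodd : Odd d) (x y : Fin d) :
    ∃ j, (next d)^[2 * j] x = y := by
  obtain ⟨j, hj⟩ := exists_next_iterate x y
  rcases Nat.even_or_odd j with h | h
  · obtain ⟨m, rfl⟩ := h
    exact ⟨m, by rw [two_mul, hj]⟩
  · obtain ⟨m, hm⟩ := h.add_odd hodd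
    refine ⟨m, ?_⟩
    rw [two_mul, ← hm, Function.iterate_add_apply, next_iterate_eq_self.2 dvd_rfl, hj]

/-! ### Words in the generators -/

/-- The wreath recursion of the generator `a_i`. -/
theorem gen_eq_node (hd : 3 ≤ d) (i : Fin d) :
    gen d i = node (swap i (next d i))
      fun x => if x = i then gen d i else if x = next d i then gen d (next d i) else 1 := by
  ext1 u
  cases u with
  | nil => rfl
  | cons x v =>
    change genFun d i (x :: v) = _
    rw [genFun, node_cons]
    by_cases h1 : x = i
    · subst h1
      simp [gen]
    · by_cases h2 : x = next d i
      · subst h2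
        simp [gen, next_ne hd]
      · simp [h1, h2, swap_apply_of_ne_of_ne]

/-- The generator `a_i` or its inverse. -/
def letter (l : Fin d × Bool) : Perm (List (Fin d)) :=
  if l.2 then gen d l.1 else (gen d l.1)⁻¹

/-- The element represented by a word in the generators and their inverses. -/
def eval (w : List (Fin d × Bool)) : Perm (List (Fin d)) := (w.map letter).prod

/-- The action of a word in the generators on the first level. -/
def wroot (w : List (Fin d × Bool)) : Perm (Fin d) :=
  (w.map fun l => swap l.1 (next d l.1)).prod

/-- The section of a letter, as a word of length at most one. -/
def lsec (l : Fin d × Bool) (x : Fin d) : List (Fin d × Bool) :=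
  if x = l.1 then [(if l.2 then l.1 else next d l.1, l.2)]
  else if x = next d l.1 then [(if l.2 then next d l.1 else l.1, l.2)] else []

/-- The section of a word in the generators, as a word. -/
def wsec : List (Fin d × Bool) → Fin d → List (Fin d × Bool)
  | [], _ => []
  | l :: w, x => lsec l (wroot w x) ++ wsec w x

/-- The total exponent of a word in the generators. -/
def wexp (w : List (Fin d × Bool)) : ℤ := (w.map fun l => if l.2 then (1 : ℤ) else -1).sum

@[simp] theorem eval_nil : eval ([] : List (Fin d × Bool)) = 1 := rfl

@[simp] theorem eval_cons (l : Fin d × Bool) (w : List (Fin d × Bool)) :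
    eval (l :: w) = letter l * eval w := by simp [eval]

@[simp] theorem eval_append (u w : List (Fin d × Bool)) : eval (u ++ w) = eval u * eval w := by
  simp [eval]

@[simp] theorem wroot_nil : wroot ([] : List (Fin d × Bool)) = 1 := rfl

@[simp] theorem wroot_cons (l : Fin d × Bool) (w : List (Fin d × Bool)) :
    wroot (l :: w) = swap l.1 (next d l.1) * wroot w := by simp [wroot]

@[simp] theorem wexp_nil : wexp ([] : List (Fin d × Bool)) = 0 := rfl

@[simp] theorem wexp_cons (l : Fin d × Bool) (w : List (Fin d × Bool)) :
    wexp (l :: w) = (if l.2 then 1 else -1) + wexp w := by simp [wexp]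

@[simp] theorem wexp_append (u w : List (Fin d × Bool)) : wexp (u ++ w) = wexp u + wexp w := by
  simp [wexp]

theorem letter_eq_node (hd : 3 ≤ d) (l : Fin d × Bool) :
    letter l = node (swap l.1 (next d l.1)) fun x => eval (lsec l x) := by
  obtain ⟨i, b⟩ := l
  have hn := next_ne hd i
  cases b
  · rw [letter, if_neg (by simp), gen_eq_node hd, node_inv]
    refine congrArg₂ node (swap_inv _ _) (funext fun x => ?_)
    by_cases h1 : x = i
    · subst h1
      simp [lsec, letter, hn]
    · by_cases h2 : x = next d i
      · subst h2
        simp [lsec, letter, hn]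
      · simp [lsec, h1, h2, swap_apply_of_ne_of_ne]
  · rw [letter, if_pos rfl, gen_eq_node hd]
    refine congrArg₂ node rfl (funext fun x => ?_)
    simp only [lsec]
    split_ifs <;> simp_all [letter]

theorem eval_eq_node (hd : 3 ≤ d) (w : List (Fin d × Bool)) :
    eval w = node (wroot w) fun x => eval (wsec w x) := by
  induction w with
  | nil => exact node_one.symm
  | cons l w ih =>
    rw [eval_cons, letter_eq_node hd, ih, node_mul, wroot_cons]
    simp [wsec]

theorem mem_G_iff {g : Perm (List (Fin d))} : g ∈ G d ↔ ∃ w, eval w = g := by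
  constructor
  · intro h
    induction h using Subgroup.closure_induction_left with
    | one => exact ⟨[], rfl⟩
    | mul_left x hx y _ ih =>
      obtain ⟨i, rfl⟩ := hx
      obtain ⟨w, rfl⟩ := ih
      exact ⟨(i, true) :: w, by simp [letter]⟩
    | inv_mul_cancel x hx y _ ih =>
      obtain ⟨i, rfl⟩ := hx
      obtain ⟨w, rfl⟩ := ih
      exact ⟨(i, false) :: w, by simp [letter]⟩
  · rintro ⟨w, rfl⟩
    refine Subgroup.list_prod_mem _ fun x hx => ?_
    obtain ⟨l, -, rfl⟩ := List.mem_map.1 hx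
    have : gen d l.1 ∈ G d := Subgroup.subset_closure ⟨l.1, rfl⟩
    rw [letter]
    split_ifs
    · exact this
    · exact inv_mem this

theorem sum_wexp_wsec (hd : 3 ≤ d) (w : List (Fin d × Bool)) :
    ∑ x, wexp (wsec w x) = 2 * wexp w := by
  induction w with
  | nil => simp [wsec]
  | cons l w ih =>
    simp only [wsec, wexp_append, sum_add_distrib, ih, wexp_cons, mul_add]
    congr 1
    rw [Equiv.sum_comp (wroot w) fun y => wexp (lsec l y)]
    have hn := next_ne hd l.1
    have : ∀ y, wexp (lsec l y) = (if y = l.1 then (if l.2 then (1 : ℤ) else -1) else 0) +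
        (if y = next d l.1 then (if l.2 then (1 : ℤ) else -1) else 0) := fun y => by
      by_cases h1 : y = l.1
      · subst h1
        simp [lsec, hn.symm]
      · by_cases h2 : y = next d l.1
        · simp [lsec, h2, hn]
        · simp [lsec, h1, h2]
    simp only [this, sum_add_distrib, sum_ite_eq', mem_univ, if_true, two_mul]

theorem length_lsec_le (l : Fin d × Bool) (x : Fin d) : (lsec l x).length ≤ 1 := by
  rw [lsec]
  split_ifs <;> simp

theorem length_wsec_le (w : List (Fin d × Bool)) (x : Fin d) :
    (wsec w x).length ≤ w.length := by
  induction w with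
  | nil => simp [wsec]
  | cons l w ih =>
    have := length_lsec_le l (wroot w x)
    simp only [wsec, List.length_append, List.length_cons]
    omega

/-- If the sections of a word at two vertices have the length of the word, then all letters of the
word exchange these two vertices. -/
theorem sym2_eq_of_length_wsec {w : List (Fin d × Bool)} {x y : Fin d} (hxy : x ≠ y)
    (hx : (wsec w x).length = w.length) (hy : (wsec w y).length = w.length) :
    (∀ l ∈ w, s(x, y) = s(l.1, next d l.1)) ∧ s(wroot w x, wroot w y) = s(x, y) := by
  induction w with
  | nil => simp
  | cons l w ih =>
    have moved : ∀ z, (wsec (l :: w) z).length = (l :: w).length →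
        (wsec w z).length = w.length ∧ (wroot w z = l.1 ∨ wroot w z = next d l.1) := by
      intro z hz
      have h1 := length_wsec_le w z
      have h2 := length_lsec_le l (wroot w z)
      simp only [wsec, List.length_append, List.length_cons] at hz
      refine ⟨by omega, ?_⟩
      by_contra hne
      push Not at hne
      have : lsec l (wroot w z) = [] := by simp [lsec, hne.1, hne.2]
      rw [this] at hz
      simp at hz
      omega
    obtain ⟨hx1, hx2⟩ := moved x hx
    obtain ⟨hy1, hy2⟩ := moved y hy
    obtain ⟨h1, h2⟩ := ih hx1 hy1
    have hne : wroot w x ≠ wroot w y := fun h => hxy ((wroot w).injective h)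
    have h3 : s(wroot w x, wroot w y) = s(l.1, next d l.1) := by
      rcases hx2 with hx2 | hx2 <;> rcases hy2 with hy2 | hy2
      · exact absurd (hx2.trans hy2.symm) hne
      · rw [hx2, hy2]
      · rw [hx2, hy2, Sym2.eq_swap]
      · exact absurd (hx2.trans hy2.symm) hne
    refine ⟨List.forall_mem_cons.2 ⟨h2.symm.trans h3, h1⟩, ?_⟩
    rw [wroot_cons, Perm.mul_apply, Perm.mul_apply, ← h2, h3]
    rcases hx2 with hx2 | hx2 <;> rcases hy2 with hy2 | hy2
    · exact absurd (hx2.trans hy2.symm) hne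
    · rw [hx2, hy2, swap_apply_left, swap_apply_right, Sym2.eq_swap]
    · rw [hx2, hy2, swap_apply_left, swap_apply_right]
    · exact absurd (hx2.trans hy2.symm) hne

theorem eq_of_sym2_next_eq (hd : 3 ≤ d) {i j : Fin d}
    (h : s(i, next d i) = s(j, next d j)) : i = j := by
  rcases Sym2.eq_iff.1 h with h | ⟨h1, h2⟩
  · exact h.1
  · exact absurd (by rw [← h1, h2]) (next_next_ne hd j)

theorem wexp_le_length (w : List (Fin d × Bool)) : wexp w ≤ w.length := by
  induction w with
  | nil => simp
  | cons l w ih =>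
    rw [wexp_cons, List.length_cons]
    push_cast
    split_ifs <;> omega

/-- The section at `x` of a power of `a_i`, for a vertex `x` moved by `a_i`. -/
theorem wsec_replicate (hd : 3 ≤ d) (i : Fin d) (n : ℕ) {x : Fin d}
    (hx : x = i ∨ x = next d i) :
    (wsec (List.replicate n (i, true)) x).length = n ∧
      wexp (wsec (List.replicate n (i, true)) x) = n ∧
      (wroot (List.replicate n (i, true)) x = i ∨
        wroot (List.replicate n (i, true)) x = next d i) := by
  have hn := next_ne hd i
  induction n with
  | zero => simpa [wsec] using hx
  | succ n ih =>
    obtain ⟨h1, h2, h3⟩ := ih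
    rw [List.replicate_succ]
    simp only [wsec, wroot_cons, Perm.mul_apply, List.length_append, wexp_append, h1, h2]
    rcases h3 with h3 | h3 <;> rw [h3] <;> simp [lsec, hn, add_comm]

theorem wsec_append (u w : List (Fin d × Bool)) (x : Fin d) :
    wsec (u ++ w) x = wsec u (wroot w x) ++ wsec w x := by
  induction u with
  | nil => simp [wsec]
  | cons l u ih => simp [wsec, ih, wroot]

theorem eval_eq_zpow {i : Fin d} {w : List (Fin d × Bool)} (h : ∀ l ∈ w, l.1 = i) :
    eval w = gen d i ^ wexp w := by
  induction w with
  | nil => simp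
  | cons l w ih =>
    rw [eval_cons, ih fun l' hl' => h l' (List.mem_cons_of_mem _ hl'), wexp_cons, zpow_add, letter,
      h l List.mem_cons_self]
    congr 1
    split_ifs <;> simp

theorem eval_wsec_eq_one (hd : 3 ≤ d) {w : List (Fin d × Bool)} (h : eval w = 1) (x : Fin d) :
    eval (wsec w x) = 1 := by
  have := (eval_eq_node hd w).symm.trans (h.trans node_one.symm)
  exact congrFun (node_injective this).2 x

theorem wroot_eq_one (hd : 3 ≤ d) {w : List (Fin d × Bool)} (h : eval w = 1) :
    wroot w = 1 := by
  have := (eval_eq_node hd w).symm.trans (h.trans node_one.symm)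
  exact (node_injective this).1

/-- The letters of a relator of length `n` with the largest positive total exponent are all equal up
to inversion, if the relators of smaller length have total exponent at most zero. -/
theorem exists_forall_fst_eq (hd : 3 ≤ d) {n : ℕ}
    (ih : ∀ w : List (Fin d × Bool), w.length < n → eval w = 1 → wexp w ≤ 0)
    {m : ℤ} (hm : 0 < m)
    (hmax : ∀ w : List (Fin d × Bool), w.length = n → eval w = 1 → wexp w ≤ m)
    {w : List (Fin d × Bool)} (hw : w.length = n) (hw1 : eval w = 1) (hwm : wexp w = m) :
    ∃ i, ∀ l ∈ w, l.1 = i := by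
  classical
  set F : Finset (Fin d) := univ.filter fun x => (wsec w x).length = n with hF
  have hle : ∀ x, wexp (wsec w x) ≤ if x ∈ F then m else 0 := by
    intro x
    have h1 := eval_wsec_eq_one hd hw1 x
    split_ifs with hx
    · exact hmax _ (by simpa [hF] using hx) h1
    · refine ih _ (lt_of_le_of_ne (hw ▸ length_wsec_le w x) fun h => hx (by simpa [hF] using h)) h1
  have hsum := sum_le_sum fun x (_ : x ∈ (univ : Finset (Fin d))) => hle x
  rw [sum_wexp_wsec hd, hwm, sum_ite_mem, univ_inter, sum_const, nsmul_eq_mul] at hsum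
  have hc : 1 < #F := by
    have : (2 : ℤ) ≤ #F := le_of_mul_le_mul_right hsum hm
    omega
  obtain ⟨x, hx, y, hy, hxy⟩ := one_lt_card.1 hc
  simp only [hF, mem_filter, mem_univ, true_and] at hx hy
  have key := (sym2_eq_of_length_wsec hxy (hx.trans hw.symm) (hy.trans hw.symm)).1
  cases w with
  | nil => exact ⟨x, by simp⟩
  | cons l w =>
    refine ⟨l.1, fun l' hl' => eq_of_sym2_next_eq hd ?_⟩
    rw [← key l' hl', key l List.mem_cons_self]

theorem wexp_nonpos_of_eval_eq_one (hd : 3 ≤ d) (n : ℕ) :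
    ∀ w : List (Fin d × Bool), w.length = n → eval w = 1 → wexp w ≤ 0 := by
  induction n using Nat.strong_induction_on with
  | _ n ih =>
    have ih' : ∀ w : List (Fin d × Bool), w.length < n → eval w = 1 → wexp w ≤ 0 :=
      fun w hw => ih _ hw w rfl
    by_contra! hcon
    obtain ⟨w₀, hw₀, hw₀1, hw₀pos⟩ := hcon
    obtain ⟨m, ⟨w, hw, hw1, hwm⟩, hmax⟩ := Int.exists_greatest_of_bdd
      (P := fun m => ∃ w : List (Fin d × Bool), w.length = n ∧ eval w = 1 ∧ wexp w = m)
      ⟨n, by rintro _ ⟨w, rfl, -, rfl⟩; exact wexp_le_length w⟩ ⟨_, w₀, hw₀, hw₀1, rfl⟩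
    have hm : 0 < m := hw₀pos.trans_le (hmax _ ⟨w₀, hw₀, hw₀1, rfl⟩)
    have hmax' : ∀ w : List (Fin d × Bool), w.length = n → eval w = 1 → wexp w ≤ m :=
      fun w h1 h2 => hmax _ ⟨w, h1, h2, rfl⟩
    obtain ⟨i, hi⟩ := exists_forall_fst_eq hd ih' hm hmax' hw hw1 hwm
    have hexp : ∀ p : ℕ, wexp (List.replicate p (i, true)) = p := fun p => by simp [wexp]
    obtain ⟨p, rfl⟩ : ∃ p : ℕ, m = p := ⟨m.toNat, by omega⟩
    have hrep : eval (List.replicate p (i, true)) = 1 := by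
      rw [eval_eq_zpow (i := i) (by simp +contextual [List.mem_replicate]), hexp, ← hwm,
        ← eval_eq_zpow hi, hw1]
    have hpn : p = n := by
      have h1 := wexp_le_length w
      by_contra hne
      have := ih' (List.replicate p (i, true)) (by simp; omega) hrep
      rw [hexp] at this
      omega
    subst hpn
    obtain ⟨h1, h2, -⟩ := wsec_replicate hd i p (Or.inl rfl)
    obtain ⟨j, hj⟩ := exists_forall_fst_eq hd ih' hm hmax' h1 (eval_wsec_eq_one hd hrep i) h2
    obtain _ | _ | p := p
    · simp at hm
    · have := congrArg (fun σ : Perm (Fin d) => σ i) (wroot_eq_one hd hrep)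
      simp [next_ne hd] at this
    · have e : List.replicate (p + 2) (i, true) = List.replicate p (i, true) ++
          [(i, true), (i, true)] := by
        rw [List.replicate_add]; rfl
      rw [e, wsec_append] at hj
      have a1 := hj (i, true) (by simp [wsec, lsec])
      have a2 := hj (next d i, true) (by simp [wsec, lsec, next_ne hd])
      exact next_ne hd i (a2.trans a1.symm)

/-- The formal inverse of a word in the generators. -/
def winv (w : List (Fin d × Bool)) : List (Fin d × Bool) :=
  (w.map fun l => (l.1, !l.2)).reverse

theorem eval_winv (w : List (Fin d × Bool)) : eval (winv w) = (eval w)⁻¹ := by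
  induction w with
  | nil => simp [winv]
  | cons l w ih =>
    have : winv (l :: w) = winv w ++ [(l.1, !l.2)] := by simp [winv]
    rw [this, eval_append, ih, eval_cons, eval_cons, mul_inv_rev, eval_nil, mul_one]
    congr 1
    rcases l with ⟨i, _ | _⟩ <;> simp [letter]

theorem wexp_winv (w : List (Fin d × Bool)) : wexp (winv w) = -wexp w := by
  induction w with
  | nil => simp [winv]
  | cons l w ih =>
    have : winv (l :: w) = winv w ++ [(l.1, !l.2)] := by simp [winv]
    rw [this, wexp_append, ih]
    rcases l with ⟨i, _ | _⟩ <;> simp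

/-- A relator of `G_d` has total exponent zero. -/
theorem wexp_eq_zero_of_eval_eq_one (hd : 3 ≤ d) {w : List (Fin d × Bool)} (h : eval w = 1) :
    wexp w = 0 := by
  have h1 := wexp_nonpos_of_eval_eq_one hd _ w rfl h
  have h2 := wexp_nonpos_of_eval_eq_one hd _ (winv w) rfl (by rw [eval_winv, h, inv_one])
  rw [wexp_winv] at h2
  omega

/-! ### The total exponent of an element of `G_d` -/

theorem eq_node (hd : 3 ≤ d) {g : Perm (List (Fin d))} (hg : g ∈ G d) :
    g = node (root g) (sec1 g) := by
  obtain ⟨w, rfl⟩ := mem_G_iff.1 hg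
  rw [eval_eq_node hd w, root_node, sec1_node]

theorem sec1_mem (hd : 3 ≤ d) {g : Perm (List (Fin d))} (hg : g ∈ G d) (x : Fin d) :
    sec1 g x ∈ G d := by
  obtain ⟨w, rfl⟩ := mem_G_iff.1 hg
  rw [eval_eq_node hd w, sec1_node]
  exact mem_G_iff.2 ⟨_, rfl⟩

theorem root_mul (hd : 3 ≤ d) {g h : Perm (List (Fin d))} (hg : g ∈ G d) (hh : h ∈ G d) :
    root (g * h) = root g * root h := by
  conv_lhs => rw [eq_node hd hg, eq_node hd hh, node_mul, root_node]

theorem sec1_mul (hd : 3 ≤ d) {g h : Perm (List (Fin d))} (hg : g ∈ G d) (hh : h ∈ G d)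
    (x : Fin d) : sec1 (g * h) x = sec1 g (root h x) * sec1 h x := by
  conv_lhs => rw [eq_node hd hg, eq_node hd hh, node_mul, sec1_node]

@[simp] theorem root_one : root (1 : Perm (List (Fin d))) = 1 := by
  rw [← node_one, root_node]

@[simp] theorem sec1_one (x : Fin d) : sec1 (1 : Perm (List (Fin d))) x = 1 := by
  conv_lhs => rw [← node_one, sec1_node]

open Classical in
/-- The total exponent of an element of `G_d`. -/
noncomputable def ex (g : Perm (List (Fin d))) : ℤ :=
  if h : ∃ w, eval w = g then wexp h.choose else 0

theorem ex_eval (hd : 3 ≤ d) (w : List (Fin d × Bool)) : ex (eval w) = wexp w := by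
  have h : ∃ w', eval w' = eval w := ⟨w, rfl⟩
  rw [ex, dif_pos h]
  have := wexp_eq_zero_of_eval_eq_one hd (w := h.choose ++ winv w)
    (by rw [eval_append, eval_winv, h.choose_spec, mul_inv_cancel])
  rw [wexp_append, wexp_winv] at this
  omega

theorem ex_mul (hd : 3 ≤ d) {g h : Perm (List (Fin d))} (hg : g ∈ G d) (hh : h ∈ G d) :
    ex (g * h) = ex g + ex h := by
  obtain ⟨u, rfl⟩ := mem_G_iff.1 hg
  obtain ⟨w, rfl⟩ := mem_G_iff.1 hh
  rw [← eval_append, ex_eval hd, ex_eval hd, ex_eval hd, wexp_append]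

theorem ex_inv (hd : 3 ≤ d) {g : Perm (List (Fin d))} (hg : g ∈ G d) : ex g⁻¹ = -ex g := by
  obtain ⟨u, rfl⟩ := mem_G_iff.1 hg
  rw [← eval_winv, ex_eval hd, ex_eval hd, wexp_winv]

theorem ex_one (hd : 3 ≤ d) : ex (1 : Perm (List (Fin d))) = 0 := ex_eval hd []

theorem gen_mem (i : Fin d) : gen d i ∈ G d := Subgroup.subset_closure ⟨i, rfl⟩

theorem exists_ex_eq (hd : 3 ≤ d) (n : ℤ) : ∃ g ∈ G d, ex g = n := by
  have key : ∀ n : ℕ, ∃ g ∈ G d, ex g = n := fun n =>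
    ⟨_, mem_G_iff.2 ⟨List.replicate n (⟨0, by omega⟩, true), rfl⟩, by
      rw [ex_eval hd]; simp [wexp]⟩
  obtain ⟨m, rfl | rfl⟩ := n.eq_nat_or_neg
  · exact key m
  · obtain ⟨g, hg, h⟩ := key m
    exact ⟨g⁻¹, inv_mem hg, by rw [ex_inv hd hg, h]⟩

theorem sum_ex_sec1 (hd : 3 ≤ d) {g : Perm (List (Fin d))} (hg : g ∈ G d) :
    ∑ x, ex (sec1 g x) = 2 * ex g := by
  obtain ⟨w, rfl⟩ := mem_G_iff.1 hg
  rw [ex_eval hd, eval_eq_node hd w, sec1_node, ← sum_wexp_wsec hd]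
  simp only [ex_eval hd]

theorem sign_wroot (hd : 3 ≤ d) (w : List (Fin d × Bool)) :
    Perm.sign (wroot w) = (-1 : ℤˣ) ^ wexp w := by
  induction w with
  | nil => simp
  | cons l w ih =>
    rw [wroot_cons, Perm.sign_mul, ih, Perm.sign_swap (next_ne hd l.1).symm, wexp_cons, zpow_add]
    split_ifs <;> simp

theorem even_ex_of_root_eq_one (hd : 3 ≤ d) {g : Perm (List (Fin d))} (hg : g ∈ G d)
    (h : root g = 1) : Even (ex g) := by
  obtain ⟨w, rfl⟩ := mem_G_iff.1 hg
  rw [eval_eq_node hd w, root_node] at h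
  have := sign_wroot hd w
  rw [h, Perm.sign_one] at this
  rw [ex_eval hd]
  by_contra hodd
  rw [Int.not_even_iff_odd] at hodd
  rw [hodd.neg_one_zpow] at this
  exact absurd this (by decide)

/-! ### Which tuples are sections of elements of the first level stabilizer -/

theorem node_one_mul (f h : Fin d → Perm (List (Fin d))) :
    node 1 f * node 1 h = node 1 (f * h) := by
  rw [node_mul]; rfl

/-- Tuples as elements that fix the first level. -/
def nodeHom (d : ℕ) : (Fin d → Perm (List (Fin d))) →* Perm (List (Fin d)) where
  toFun := node 1
  map_one' := node_one
  map_mul' f h := (node_one_mul f h).symm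

theorem node_conj (σ : Perm (Fin d)) (s : Fin d → Perm (List (Fin d))) (x : Fin d)
    (h : Perm (List (Fin d))) :
    node σ s * node 1 (Pi.mulSingle x h) * (node σ s)⁻¹ =
      node 1 (Pi.mulSingle (σ x) (s x * h * (s x)⁻¹)) := by
  rw [node_inv, node_mul, node_mul, mul_one, mul_inv_cancel]
  congr 1
  ext1 y
  by_cases hy : y = σ x
  · subst hy
    simp
  · have : σ⁻¹ y ≠ x := fun e => hy (by rw [← e]; simp)
    simp only [Pi.mulSingle_eq_of_ne hy, Pi.mulSingle_eq_of_ne this, Perm.one_apply, mul_one,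
      mul_inv_cancel]

/-- The elements of `G_d` which, acting on the subtree of the first level vertex `x`, give an element
of `G_d`. -/
def ristSec (x : Fin d) : Subgroup (Perm (List (Fin d))) :=
  G d ⊓ (G d).comap ((nodeHom d).comp (MonoidHom.mulSingle (fun _ : Fin d => Perm (List (Fin d))) x))

theorem mem_ristSec {x : Fin d} {h : Perm (List (Fin d))} :
    h ∈ ristSec x ↔ h ∈ G d ∧ node 1 (Pi.mulSingle x h) ∈ G d := Iff.rfl

theorem conj_mem_ristSec (hd : 3 ≤ d) {g h : Perm (List (Fin d))} (hg : g ∈ G d) {x : Fin d}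
    (hh : h ∈ ristSec x) : sec1 g x * h * (sec1 g x)⁻¹ ∈ ristSec (root g x) := by
  rw [mem_ristSec] at hh ⊢
  have hs := sec1_mem hd hg x
  refine ⟨mul_mem (mul_mem hs hh.1) (inv_mem hs), ?_⟩
  rw [← node_conj, ← eq_node hd hg]
  exact mul_mem (mul_mem hg hh.2) (inv_mem hg)

theorem root_eval (hd : 3 ≤ d) (w : List (Fin d × Bool)) : root (eval w) = wroot w := by
  rw [eval_eq_node hd, root_node]

theorem sec1_eval (hd : 3 ≤ d) (w : List (Fin d × Bool)) (x : Fin d) :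
    sec1 (eval w) x = eval (wsec w x) := by
  conv_lhs => rw [eval_eq_node hd, sec1_node]

/-- `G_d` acts transitively on the first level by elements with trivial section. -/
theorem exists_root_eq_sec1_eq_one (hd : 3 ≤ d) (hodd : Odd d) (x y : Fin d) :
    ∃ g ∈ G d, root g x = y ∧ sec1 g x = 1 := by
  obtain ⟨j, rfl⟩ := exists_next_iterate_two_mul hodd x y
  induction j with
  | zero => exact ⟨1, one_mem _, by simp, by simp⟩
  | succ j ih =>
    obtain ⟨g, hg, h1, h2⟩ := ih
    set z := (next d)^[2 * j] x
    have hm : eval [(next d z, true), (z, false)] ∈ G d := mem_G_iff.2 ⟨_, rfl⟩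
    refine ⟨_, mul_mem hm hg, ?_, ?_⟩
    · rw [root_mul hd hm hg, Perm.mul_apply, h1, root_eval hd, mul_add, add_comm, mul_one,
        Function.iterate_add_apply]
      simp [z]
    · rw [sec1_mul hd hm hg, h1, h2, sec1_eval hd]
      simp [wsec, lsec, letter]

theorem ristSec_le (hd : 3 ≤ d) (hodd : Odd d) (x y : Fin d) : ristSec x ≤ ristSec y := by
  intro h hh
  obtain ⟨g, hg, rfl, h2⟩ := exists_root_eq_sec1_eq_one hd hodd x y
  have := conj_mem_ristSec hd hg hh
  rwa [h2, one_mul, inv_one, mul_one] at this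

theorem letter_conj_mem_ristSec (hd : 3 ≤ d) (hodd : Odd d) (l : Fin d × Bool)
    {h : Perm (List (Fin d))} {x : Fin d} (hh : h ∈ ristSec x) :
    letter l * h * (letter l)⁻¹ ∈ ristSec x := by
  have hn := next_ne hd l.1
  have hm : eval [l] ∈ G d := mem_G_iff.2 ⟨_, rfl⟩
  have := conj_mem_ristSec hd hm
    (ristSec_le hd hodd x (if l.2 then l.1 else next d l.1) hh)
  refine ristSec_le hd hodd _ x (by
    rw [sec1_eval hd] at this
    convert this using 1
    have e : eval (wsec [l] (if l.2 then l.1 else next d l.1)) = letter l := by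
      rcases l with ⟨i, _ | _⟩ <;> simp [wsec, lsec, hn]
    rw [e])

/-- The braid relation fails on a single subtree only. -/
theorem node_braid (hd : 3 ≤ d) (i : Fin d) :
    eval [(i, true), (next d i, true), (i, true)] =
      node 1 (Pi.mulSingle (next d i) (gen d i * (gen d (next d (next d i)))⁻¹)) *
        eval [(next d i, true), (i, true), (next d i, true)] := by
  have h1 := next_ne hd i
  have h2 := next_ne hd (next d i)
  have h3 := next_next_ne hd i
  rw [eval_eq_node hd, eval_eq_node hd [(next d i, true), (i, true), (next d i, true)], node_mul]
  have key : ∀ y : Fin d, y = i ∨ y = next d i ∨ y = next d (next d i) ∨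
      (y ≠ i ∧ y ≠ next d i ∧ y ≠ next d (next d i)) := fun y => by tauto
  congr 1
  · ext1 y
    rcases key y with rfl | rfl | rfl | ⟨k1, k2, k3⟩ <;>
      simp [swap_apply_def, *, Ne.symm]
  · ext1 y
    rcases key y with rfl | rfl | rfl | ⟨k1, k2, k3⟩ <;>
      simp [wsec, lsec, letter, swap_apply_def, *, Ne.symm]

theorem gen_mul_inv_gen_mem_ristSec (hd : 3 ≤ d) (hodd : Odd d) (i j x : Fin d) :
    gen d i * (gen d j)⁻¹ ∈ ristSec x := by
  obtain ⟨m, rfl⟩ := exists_next_iterate_two_mul hodd i j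
  induction m with
  | zero => simp
  | succ m ih =>
    set z := (next d)^[2 * m] i
    have hz : (next d)^[2 * (m + 1)] i = next d (next d z) := by
      rw [mul_add, add_comm, mul_one, Function.iterate_add_apply]
      rfl
    have h1 : gen d z * (gen d (next d (next d z)))⁻¹ ∈ ristSec (next d z) := by
      refine mem_ristSec.2 ⟨mul_mem (gen_mem _) (inv_mem (gen_mem _)), ?_⟩
      rw [eq_mul_inv_of_mul_eq (node_braid hd z).symm]
      exact mul_mem (mem_G_iff.2 ⟨_, rfl⟩) (inv_mem (mem_G_iff.2 ⟨_, rfl⟩))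
    rw [hz]
    have := mul_mem ih (ristSec_le hd hodd _ x h1)
    simpa [mul_assoc] using this

theorem eval_mul_zpow_mem_ristSec (hd : 3 ≤ d) (hodd : Odd d) (x i : Fin d)
    (w : List (Fin d × Bool)) : eval w * gen d i ^ (-wexp w) ∈ ristSec x := by
  induction w with
  | nil => simp
  | cons l w ih =>
    have h1 := letter_conj_mem_ristSec hd hodd l ih
    have h2 : letter l * gen d i ^ (-(if l.2 then (1 : ℤ) else -1)) ∈ ristSec x := by
      rcases l with ⟨j, _ | _⟩
      · have := letter_conj_mem_ristSec hd hodd (j, false)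
          (gen_mul_inv_gen_mem_ristSec hd hodd i j x)
        simpa [letter, mul_assoc] using this
      · simpa [letter] using gen_mul_inv_gen_mem_ristSec hd hodd j i x
    have := mul_mem h1 h2
    rw [eval_cons, wexp_cons, neg_add_rev, zpow_add]
    simpa [mul_assoc] using this

theorem mem_ristSec_of_ex_eq_zero (hd : 3 ≤ d) (hodd : Odd d) (x : Fin d)
    {g : Perm (List (Fin d))} (hg : g ∈ G d) (h : ex g = 0) : g ∈ ristSec x := by
  obtain ⟨w, rfl⟩ := mem_G_iff.1 hg
  rw [ex_eval hd] at h
  simpa [h] using eval_mul_zpow_mem_ristSec hd hodd x x w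

/-- The vectors of the total exponents of the sections of elements of the first level stabilizer. -/
noncomputable def exVectors (hd : 3 ≤ d) : AddSubgroup (Fin d → ℤ) where
  carrier := {v | ∃ f, (∀ x, f x ∈ G d ∧ ex (f x) = v x) ∧ node 1 f ∈ G d}
  zero_mem' := ⟨1, fun _ => ⟨one_mem _, ex_one hd⟩, by
    change nodeHom d 1 ∈ G d
    rw [map_one]; exact one_mem _⟩
  add_mem' := by
    rintro v w ⟨f, hf, hf'⟩ ⟨h, hh, hh'⟩
    refine ⟨f * h, fun x => ⟨mul_mem (hf x).1 (hh x).1, ?_⟩, ?_⟩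
    · rw [Pi.mul_apply, ex_mul hd (hf x).1 (hh x).1, (hf x).2, (hh x).2, Pi.add_apply]
    · rw [← node_one_mul]
      exact mul_mem hf' hh'
  neg_mem' := by
    rintro v ⟨f, hf, hf'⟩
    refine ⟨f⁻¹, fun x => ⟨inv_mem (hf x).1, ?_⟩, ?_⟩
    · rw [Pi.inv_apply, ex_inv hd (hf x).1, (hf x).2, Pi.neg_apply]
    · change nodeHom d f⁻¹ ∈ G d
      rw [map_inv]; exact inv_mem hf'

theorem wexp_wsec_mem_exVectors (hd : 3 ≤ d) {w : List (Fin d × Bool)} (h : wroot w = 1) :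
    (fun x => wexp (wsec w x)) ∈ exVectors hd :=
  ⟨fun x => eval (wsec w x), fun _ => ⟨mem_G_iff.2 ⟨_, rfl⟩, ex_eval hd _⟩,
    mem_G_iff.2 ⟨w, by rw [eval_eq_node hd, h]⟩⟩

theorem two_single_add_mem_exVectors (hd : 3 ≤ d) (x : Fin d) :
    Pi.single x 2 + Pi.single (next d x) 2 ∈ exVectors hd := by
  have hn := next_ne hd x
  convert wexp_wsec_mem_exVectors hd (w := [(x, true), (x, true)]) (by simp) using 1
  ext y
  by_cases h1 : y = x
  · subst h1
    simp [wsec, lsec, hn, hn.symm]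
  · by_cases h2 : y = next d x
    · subst h2
      simp [wsec, lsec, hn]
    · simp [wsec, lsec, h1, h2, swap_apply_of_ne_of_ne]

theorem two_single_sub_mem_exVectors (hd : 3 ≤ d) (hodd : Odd d) (x y : Fin d) :
    Pi.single x 2 - Pi.single y 2 ∈ exVectors hd := by
  obtain ⟨m, rfl⟩ := exists_next_iterate_two_mul hodd x y
  induction m with
  | zero => simp
  | succ m ih =>
    set z := (next d)^[2 * m] x
    have hz : (next d)^[2 * (m + 1)] x = next d (next d z) := by
      rw [mul_add, add_comm, mul_one, Function.iterate_add_apply]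
      rfl
    rw [hz]
    have := sub_mem (add_mem ih (two_single_add_mem_exVectors hd z))
      (two_single_add_mem_exVectors hd (next d z))
    convert this using 1
    abel

theorem four_single_mem_exVectors (hd : 3 ≤ d) (hodd : Odd d) (x : Fin d) :
    Pi.single x 4 ∈ exVectors hd := by
  have := add_mem (two_single_add_mem_exVectors hd x)
    (two_single_sub_mem_exVectors hd hodd x (next d x))
  convert this using 1
  rw [show (4 : ℤ) = 2 + 2 from rfl, Pi.single_add]
  abel

/-- A word that acts on the first level as the transposition `(x  x+j+1)`. -/
def transpositionWord (x : Fin d) : ℕ → List (Fin d × Bool)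
  | 0 => [(x, true)]
  | j + 1 => ((next d)^[j + 1] x, true) ::
      (transpositionWord x j ++ [((next d)^[j + 1] x, false)])

set_option linter.unusedSimpArgs false in
theorem transpositionWord_spec (hd : 3 ≤ d) (x : Fin d) (j : ℕ) (hj : j + 1 < d) :
    wroot (transpositionWord x j) = swap x ((next d)^[j + 1] x) ∧
      ∀ y, wexp (wsec (transpositionWord x j) y) =
        if y = x then (j : ℤ) + 1 else if y = (next d)^[j + 1] x then 1 - (j : ℤ) else 0 := by
  induction j with
  | zero =>
    refine ⟨by simp [transpositionWord], fun y => ?_⟩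
    simp only [transpositionWord, wsec, lsec]
    by_cases h1 : y = x
    · simp [h1]
    · by_cases h2 : y = next d x <;> simp [h1, h2, next_ne hd]
  | succ j ih =>
    obtain ⟨h1, h2⟩ := ih (by omega)
    have hz : (next d)^[j + 1 + 1] x = next d ((next d)^[j + 1] x) :=
      Function.iterate_succ_apply' _ _ _
    have n1 : (next d)^[j + 1] x ≠ x := fun h => by
      have := Nat.le_of_dvd (by omega) (next_iterate_eq_self.1 h)
      omega
    have n2 : (next d)^[j + 1 + 1] x ≠ x := fun h => by
      have := Nat.le_of_dvd (by omega) (next_iterate_eq_self.1 h)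
      omega
    rw [hz] at n2 ⊢
    set z := (next d)^[j + 1] x with hzdef
    have n3 := next_ne hd z
    have happ : wroot (transpositionWord x j ++ [(z, false)]) = swap x z * swap z (next d z) := by
      rw [← h1]; simp [wroot]
    have key : ∀ y : Fin d, y = x ∨ y = z ∨ y = next d z ∨
      (y ≠ x ∧ y ≠ z ∧ y ≠ next d z) := fun y => by tauto
    have e : transpositionWord x (j + 1) = (z, true) :: (transpositionWord x j ++ [(z, false)]) :=
      rfl
    rw [e]
    constructor
    · rw [wroot_cons, happ]
      ext1 y
      rcases key y with rfl | hy | hy | ⟨k1, k2, k3⟩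
      · simp [swap_apply_def, n1, n2, n3, n1.symm, n2.symm, n3.symm]
      · simp [swap_apply_def, hy, n1, n2, n3, n1.symm, n2.symm, n3.symm]
      · simp [swap_apply_def, hy, n1, n2, n3, n1.symm, n2.symm, n3.symm]
      · simp [swap_apply_def, k1, k2, k3]
    · intro y
      simp only [wsec, wexp_append, happ, wsec_append, h2, wroot_cons, wroot_nil, mul_one,
        Perm.mul_apply, lsec, wexp_nil, Perm.one_apply, add_zero]
      rcases key y with rfl | hy | hy | ⟨k1, k2, k3⟩
      · simp [swap_apply_def, n1, n2, n3, n1.symm, n2.symm, n3.symm, add_comm]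
      · simp [swap_apply_def, hy, n1, n2, n3, n1.symm, n2.symm, n3.symm]
      · simp [swap_apply_def, hy, n1, n2, n3, n1.symm, n2.symm, n3.symm]
        ring
      · simp [swap_apply_def, k1, k2, k3]

theorem single_sub_single_next_mem_exVectors (hd : 3 ≤ d) (hodd : Odd d) (p : Fin d) :
    Pi.single p 1 - Pi.single (next d p) 1 ∈ exVectors hd := by
  have n1 := next_ne hd p
  set x := next d p with hx
  have hp : (next d)^[d - 2 + 1] x = p := by
    rw [hx, ← Function.iterate_succ_apply, next_iterate_eq_self]
    exact dvd_of_eq (by omega)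
  obtain ⟨h1, h2⟩ := transpositionWord_spec hd x (d - 2) (by omega)
  rw [hp] at h1 h2
  have h3 := wexp_wsec_mem_exVectors hd (w := transpositionWord x (d - 2) ++ [(p, false)]) (by
    have : wroot (transpositionWord x (d - 2) ++ [(p, false)]) = swap x p * swap p x := by
      rw [← h1]; simp [wroot, hx]
    rw [this, swap_comm, swap_mul_self])
  obtain ⟨m, hm⟩ := hodd
  convert sub_mem h3 (zsmul_mem (two_single_sub_mem_exVectors hd ⟨m, hm⟩ p x) (m - 1)) using 1
  ext y
  have hc : ((d - 2 : ℕ) : ℤ) = 2 * m - 1 := by omega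
  simp only [wsec_append, wsec, lsec, wexp_append, h2, hc, wroot_cons, wroot_nil, mul_one, ← hx,
    Perm.one_apply, wexp_nil, add_zero]
  by_cases h1 : y = p
  · subst h1
    simp [n1.symm]
    ring
  · by_cases h2 : y = x
    · simp [h2, n1, n1.symm]
      ring
    · simp [h1, h2, swap_apply_of_ne_of_ne]

theorem single_sub_single_mem_exVectors (hd : 3 ≤ d) (hodd : Odd d) (x y : Fin d) :
    Pi.single x 1 - Pi.single y 1 ∈ exVectors hd := by
  obtain ⟨m, rfl⟩ := exists_next_iterate x y
  induction m with
  | zero => simp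
  | succ m ih =>
    rw [Function.iterate_succ_apply']
    simpa using add_mem ih (single_sub_single_next_mem_exVectors hd hodd ((next d)^[m] x))

theorem mem_exVectors_of_dvd (hd : 3 ≤ d) (hodd : Odd d) {v : Fin d → ℤ} (h : 4 ∣ ∑ x, v x) :
    v ∈ exVectors hd := by
  obtain ⟨c, hc⟩ := h
  set x₀ : Fin d := ⟨0, by omega⟩
  have h1 : ∑ x, v x • (Pi.single x 1 - Pi.single x₀ 1 : Fin d → ℤ) + c • Pi.single x₀ 4 = v := by
    ext y
    simp only [smul_sub, sum_sub_distrib, ← sum_smul, hc, Pi.add_apply, Pi.sub_apply, Finset.sum_apply,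
      Pi.smul_apply, Pi.single_apply, smul_eq_mul]
    simp
    split_ifs <;> ring
  rw [← h1]
  exact add_mem (sum_mem fun x _ => zsmul_mem (single_sub_single_mem_exVectors hd hodd x x₀) _)
    (zsmul_mem (four_single_mem_exVectors hd hodd x₀) _)

/-- A tuple of elements of `G_d` is the tuple of sections of an element of the first level stabilizer
if and only if four divides the sum of the total exponents. -/
theorem node_one_mem_G_iff (hd : 3 ≤ d) (hodd : Odd d) {f : Fin d → Perm (List (Fin d))}
    (hf : ∀ x, f x ∈ G d) : node 1 f ∈ G d ↔ 4 ∣ ∑ x, ex (f x) := by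
  constructor
  · intro h
    obtain ⟨c, hc⟩ := even_ex_of_root_eq_one hd h (root_node _ _)
    have := sum_ex_sec1 hd h
    rw [sec1_node] at this
    exact ⟨c, by rw [this, hc]; ring⟩
  · intro h
    obtain ⟨f', hf', hm⟩ := mem_exVectors_of_dvd hd hodd h
    have : node 1 f = node 1 f' * node 1 (f'⁻¹ * f) := by
      rw [node_one_mul, mul_inv_cancel_left]
    rw [this]
    refine mul_mem hm (Subgroup.pi_mem_of_mulSingle_mem (H := (G d).comap (nodeHom d)) _ fun x => ?_)
    refine (mem_ristSec.1 (mem_ristSec_of_ex_eq_zero hd hodd x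
      (mul_mem (inv_mem (hf' x).1) (hf x)) ?_)).2
    rw [ex_mul hd (inv_mem (hf' x).1) (hf x), ex_inv hd (hf' x).1, (hf' x).2, neg_add_cancel]

/-! ### Sections at arbitrary vertices -/

/-- The section at a vertex. -/
noncomputable def sec (g : Perm (List (Fin d))) : List (Fin d) → Perm (List (Fin d))
  | [] => g
  | x :: u => sec (sec1 g x) u

@[simp] theorem sec_nil (g : Perm (List (Fin d))) : sec g [] = g := rfl

@[simp] theorem sec_cons (g : Perm (List (Fin d))) (x : Fin d) (u : List (Fin d)) :
    sec g (x :: u) = sec (sec1 g x) u := rfl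

theorem sec_append (g : Perm (List (Fin d))) (u v : List (Fin d)) :
    sec g (u ++ v) = sec (sec g u) v := by
  induction u generalizing g with
  | nil => rfl
  | cons x u ih => simp [ih]

theorem sec_mem (hd : 3 ≤ d) {g : Perm (List (Fin d))} (hg : g ∈ G d) (u : List (Fin d)) :
    sec g u ∈ G d := by
  induction u generalizing g with
  | nil => exact hg
  | cons x u ih => exact ih (sec1_mem hd hg x)

@[simp] theorem sec_one (u : List (Fin d)) : sec (1 : Perm (List (Fin d))) u = 1 := by
  induction u with
  | nil => rfl
  | cons x u ih => simp [ih]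

theorem sum_ex_sec (hd : 3 ≤ d) {g : Perm (List (Fin d))} (hg : g ∈ G d) (u : List (Fin d)) :
    ∑ x, ex (sec g (u ++ [x])) = 2 * ex (sec g u) := by
  simpa [sec_append] using sum_ex_sec1 hd (sec_mem hd hg u)

/-! ### Level stabilizers -/

theorem mem_levelStab_zero {g : Perm (List (Fin d))} (hg : g ∈ G d) :
    g ∈ levelStab (G d) 0 :=
  ⟨hg, fun u hu => by
    rw [List.length_eq_zero_iff.1 hu]
    exact (G_le_autTree d hg).1⟩

theorem mem_levelStab_succ (hd : 3 ≤ d) {g : Perm (List (Fin d))} {k : ℕ} (hg : g ∈ G d) :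
    g ∈ levelStab (G d) (k + 1) ↔ root g = 1 ∧ ∀ x, sec1 g x ∈ levelStab (G d) k := by
  have key : ∀ x u, g (x :: u) = root g x :: sec1 g x u := fun x u => by
    conv_lhs => rw [eq_node hd hg, node_cons]
  constructor
  · rintro ⟨-, h⟩
    have h' : ∀ x u, u.length = k → root g x = x ∧ sec1 g x u = u := fun x u hu => by
      have := h (x :: u) (by simp [hu])
      rwa [key, List.cons_eq_cons] at this
    exact ⟨Equiv.ext fun x => (h' x (List.replicate k x) (by simp)).1,
      fun x => ⟨sec1_mem hd hg x, fun u hu => (h' x u hu).2⟩⟩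
  · rintro ⟨h1, h2⟩
    refine ⟨hg, fun u hu => ?_⟩
    cases u with
    | nil => simp at hu
    | cons x u => rw [key, h1, (h2 x).2 u (by simpa using hu)]; rfl

theorem sec_mem_levelStab (hd : 3 ≤ d) {g : Perm (List (Fin d))} {k : ℕ} {u : List (Fin d)}
    (hg : g ∈ levelStab (G d) (u.length + k)) : sec g u ∈ levelStab (G d) k := by
  induction u generalizing g with
  | nil => simpa using hg
  | cons x u ih =>
    rw [List.length_cons, add_right_comm, mem_levelStab_succ hd hg.1] at hg
    exact ih (hg.2 x)

theorem sec_mul (hd : 3 ≤ d) {g h : Perm (List (Fin d))} {k : ℕ} (hg : g ∈ levelStab (G d) k)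
    (hh : h ∈ levelStab (G d) k) {u : List (Fin d)} (hu : u.length ≤ k) :
    sec (g * h) u = sec g u * sec h u := by
  induction u generalizing g h k with
  | nil => rfl
  | cons x u ih =>
    obtain _ | k := k
    · simp at hu
    · have hgG := hg.1
      have hhG := hh.1
      rw [mem_levelStab_succ hd hgG] at hg
      rw [mem_levelStab_succ hd hhG] at hh
      rw [sec_cons, sec1_mul hd hgG hhG, hh.1, Perm.one_apply,
        ih (hg.2 x) (hh.2 x) (by simpa using hu)]
      rfl

theorem sec_inv (hd : 3 ≤ d) {g : Perm (List (Fin d))} {k : ℕ} (hg : g ∈ levelStab (G d) k)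
    {u : List (Fin d)} (hu : u.length ≤ k) : sec g⁻¹ u = (sec g u)⁻¹ := by
  rw [eq_inv_iff_mul_eq_one, ← sec_mul hd (inv_mem hg) hg hu, inv_mul_cancel, sec_one]

theorem ex_sec_mul (hd : 3 ≤ d) {g h : Perm (List (Fin d))} {k : ℕ}
    (hg : g ∈ levelStab (G d) k) (hh : h ∈ levelStab (G d) k) {u : List (Fin d)}
    (hu : u.length ≤ k) : ex (sec (g * h) u) = ex (sec g u) + ex (sec h u) := by
  rw [sec_mul hd hg hh hu, ex_mul hd (sec_mem hd hg.1 u) (sec_mem hd hh.1 u)]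

theorem even_ex_sec (hd : 3 ≤ d) {g : Perm (List (Fin d))} {k : ℕ}
    (hg : g ∈ levelStab (G d) k) {u : List (Fin d)} (hu : u.length < k) :
    Even (ex (sec g u)) := by
  obtain ⟨j, rfl⟩ := Nat.exists_eq_add_of_lt hu
  rw [add_assoc] at hg
  have := sec_mem_levelStab hd hg
  exact even_ex_of_root_eq_one hd this.1 ((mem_levelStab_succ hd this.1).1 this).1

theorem eq_one_of_sec_eq_one (hd : 3 ≤ d) {g : Perm (List (Fin d))} {k : ℕ}
    (hg : g ∈ levelStab (G d) k) (h : ∀ u : List (Fin d), u.length = k → sec g u = 1) :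
    g = 1 := by
  induction k generalizing g with
  | zero => exact h [] rfl
  | succ k ih =>
    have hgG := hg.1
    rw [mem_levelStab_succ hd hgG] at hg
    rw [eq_node hd hgG, hg.1, ← node_one]
    congr 1
    ext1 x
    exact ih (hg.2 x) fun u hu => h (x :: u) (by simp [hu])

/-! ### Rigid stabilizers -/

/-- The permutation acting by `h` on the subtree of the vertex `u` and trivially elsewhere. -/
def atVertex (h : Perm (List (Fin d))) : List (Fin d) → Perm (List (Fin d))
  | [] => h
  | x :: u => node 1 (Pi.mulSingle x (atVertex h u))

theorem sum_ex_mulSingle (hd : 3 ≤ d) (x : Fin d) (h : Perm (List (Fin d))) :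
    ∑ y, ex ((Pi.mulSingle x h : Fin d → Perm (List (Fin d))) y) = ex h := by
  rw [sum_eq_single x (fun y _ hy => by rw [Pi.mulSingle_eq_of_ne hy, ex_one hd]) (by simp),
    Pi.mulSingle_eq_same]

theorem atVertex_cons_mem_iff (hd : 3 ≤ d) (hodd : Odd d) {h : Perm (List (Fin d))} (x : Fin d)
    (u : List (Fin d)) :
    atVertex h (x :: u) ∈ G d ↔ atVertex h u ∈ G d ∧ 4 ∣ ex (atVertex h u) := by
  have aux : ∀ k ∈ G d, ∀ y, (Pi.mulSingle x k : Fin d → Perm (List (Fin d))) y ∈ G d := by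
    intro k hk y
    by_cases hy : y = x
    · subst hy
      rwa [Pi.mulSingle_eq_same]
    · rw [Pi.mulSingle_eq_of_ne hy]
      exact one_mem _
  constructor
  · intro hm
    have h1 := sec1_mem hd hm x
    rw [atVertex, sec1_node, Pi.mulSingle_eq_same] at h1
    rw [atVertex, node_one_mem_G_iff hd hodd (aux _ h1), sum_ex_mulSingle hd] at hm
    exact ⟨h1, hm⟩
  · rintro ⟨h1, h2⟩
    rw [atVertex, node_one_mem_G_iff hd hodd (aux _ h1), sum_ex_mulSingle hd]
    exact h2

theorem pow_mul_ex_atVertex (hd : 3 ≤ d) (hodd : Odd d) {h : Perm (List (Fin d))}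
    {u : List (Fin d)} (hu : atVertex h u ∈ G d) :
    2 ^ u.length * ex (atVertex h u) = ex h := by
  induction u with
  | nil => simp [atVertex]
  | cons x u ih =>
    have h1 := sum_ex_sec1 hd hu
    rw [atVertex, sec1_node, sum_ex_mulSingle hd] at h1
    rw [← ih ((atVertex_cons_mem_iff hd hodd x u).1 hu).1, h1, List.length_cons, pow_succ, mul_assoc]
    rfl

/-- An element `h` of `G_d` acting on the subtree of `u` is in `G_d` if its total exponent is
divisible by a certain power of two. -/
theorem atVertex_mem (hd : 3 ≤ d) (hodd : Odd d) {h : Perm (List (Fin d))} (hh : h ∈ G d)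
    {u : List (Fin d)} (hdvd : 2 ^ (u.length + 1) ∣ ex h) : atVertex h u ∈ G d := by
  induction u with
  | nil => exact hh
  | cons x u ih =>
    rw [List.length_cons] at hdvd
    have h1 := ih ((pow_dvd_pow 2 (by omega)).trans hdvd)
    refine (atVertex_cons_mem_iff hd hodd x u).2 ⟨h1, ?_⟩
    rw [← pow_mul_ex_atVertex hd hodd h1, add_assoc, pow_add] at hdvd
    exact (mul_dvd_mul_iff_left (by positivity)).1 hdvd

theorem dvd_ex_of_atVertex_mem (hd : 3 ≤ d) (hodd : Odd d) {h : Perm (List (Fin d))}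
    {u : List (Fin d)} (hne : u ≠ []) (hu : atVertex h u ∈ G d) :
    2 ^ (u.length + 1) ∣ ex h := by
  cases u with
  | nil => exact absurd rfl hne
  | cons x u =>
    obtain ⟨h1, h2⟩ := (atVertex_cons_mem_iff hd hodd x u).1 hu
    rw [← pow_mul_ex_atVertex hd hodd h1, List.length_cons, add_assoc, pow_add]
    exact mul_dvd_mul_left _ h2

theorem sec_atVertex_self (h : Perm (List (Fin d))) (u : List (Fin d)) :
    sec (atVertex h u) u = h := by
  induction u with
  | nil => rfl
  | cons x u ih => rw [atVertex, sec_cons, sec1_node, Pi.mulSingle_eq_same, ih]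

theorem sec_atVertex_of_ne (h : Perm (List (Fin d))) {u v : List (Fin d)}
    (hl : v.length = u.length) (hne : v ≠ u) : sec (atVertex h u) v = 1 := by
  induction u generalizing v with
  | nil => exact absurd (List.length_eq_zero_iff.1 hl) hne
  | cons x u ih =>
    cases v with
    | nil => simp at hl
    | cons y v =>
      rw [atVertex, sec_cons, sec1_node]
      by_cases hy : y = x
      · subst hy
        rw [Pi.mulSingle_eq_same]
        exact ih (by simpa using hl) fun e => hne (by rw [e])
      · rw [Pi.mulSingle_eq_of_ne hy, sec_one]

theorem atVertex_apply_of_not_prefix (h : Perm (List (Fin d))) {u w : List (Fin d)}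
    (hw : ¬ u <+: w) : atVertex h u w = w := by
  induction u generalizing w with
  | nil => exact absurd List.nil_prefix hw
  | cons x u ih =>
    cases w with
    | nil => rfl
    | cons y w =>
      rw [atVertex, node_cons]
      by_cases hy : y = x
      · subst hy
        rw [Pi.mulSingle_eq_same, ih fun e => hw (List.cons_prefix_cons.2 ⟨rfl, e⟩)]
        rfl
      · rw [Pi.mulSingle_eq_of_ne hy]
        rfl

theorem eq_atVertex_of_mem_rist (hd : 3 ≤ d) {g : Perm (List (Fin d))} {u : List (Fin d)}
    (hg : g ∈ rist (G d) u) : g = atVertex (sec g u) u := by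
  induction u generalizing g with
  | nil => rfl
  | cons x u ih =>
    obtain ⟨hgG, hg⟩ := hg
    have key : ∀ y w, g (y :: w) = root g y :: sec1 g y w := fun y w => by
      conv_lhs => rw [eq_node hd hgG, node_cons]
    have h1 : ∀ y w, (y ≠ x ∨ ¬ u <+: w) → root g y = y ∧ sec1 g y w = w := fun y w hy => by
      have := hg (y :: w) (by rw [List.cons_prefix_cons]; rintro ⟨rfl, h⟩; tauto)
      rwa [key, List.cons_eq_cons] at this
    have h2 : root g = 1 := by
      have hne : ∀ y, y ≠ x → root g y = y := fun y hy => (h1 y [] (Or.inl hy)).1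
      ext1 y
      by_cases hy : y = x
      · subst hy
        by_contra hc
        exact hc ((root g).injective (hne _ hc))
      · exact hne y hy
    have h3 : sec1 g x ∈ rist (G d) u :=
      ⟨sec1_mem hd hgG x, fun w hw => (h1 x w (Or.inr hw)).2⟩
    rw [atVertex, sec_cons, ← ih h3]
    conv_lhs => rw [eq_node hd hgG, h2]
    congr 1
    ext1 y
    by_cases hy : y = x
    · subst hy
      rw [Pi.mulSingle_eq_same]
    · rw [Pi.mulSingle_eq_of_ne hy]
      exact Equiv.ext fun w => (h1 y w (Or.inl hy)).2

theorem atVertex_mem_levelRist (hd : 3 ≤ d) (hodd : Odd d) {h : Perm (List (Fin d))}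
    (hh : h ∈ G d) {u : List (Fin d)} (hdvd : 2 ^ (u.length + 1) ∣ ex h) :
    atVertex h u ∈ levelRist (G d) u.length :=
  Subgroup.subset_closure ⟨u, rfl, atVertex_mem hd hodd hh hdvd,
    fun _ => atVertex_apply_of_not_prefix h⟩

theorem mem_levelRist_of_dvd (hd : 3 ≤ d) (hodd : Odd d) {k : ℕ} (s : Finset (List (Fin d)))
    {g : Perm (List (Fin d))} (hg : g ∈ levelStab (G d) k)
    (hdvd : ∀ u : List (Fin d), u.length = k → 2 ^ (k + 1) ∣ ex (sec g u))
    (hs : ∀ u : List (Fin d), u.length = k → u ∉ s → sec g u = 1) :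
    g ∈ levelRist (G d) k := by
  induction s using Finset.induction_on generalizing g with
  | empty =>
    rw [eq_one_of_sec_eq_one hd hg fun u hu => hs u hu (notMem_empty u)]
    exact one_mem _
  | insert u s _ ih =>
    by_cases hu : u.length = k
    · subst hu
      have hm := atVertex_mem_levelRist hd hodd (sec_mem hd hg.1 u) (hdvd u rfl)
      have hst := levelRist_le_levelStab (G_le_autTree d) _ hm
      have hsec : ∀ v : List (Fin d), v.length = u.length →
          sec ((atVertex (sec g u) u)⁻¹ * g) v = if v = u then 1 else sec g v := fun v hv => by
        rw [sec_mul hd (inv_mem hst) hg hv.le, sec_inv hd hst hv.le]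
        split_ifs with hvu
        · rw [hvu, sec_atVertex_self, inv_mul_cancel]
        · rw [sec_atVertex_of_ne _ hv hvu, inv_one, one_mul]
      have := ih (g := (atVertex (sec g u) u)⁻¹ * g) (mul_mem (inv_mem hst) hg)
        (fun v hv => by
          rw [hsec v hv]
          split_ifs
          · simp [ex_one hd]
          · exact hdvd v hv)
        (fun v hv hvs => by
          rw [hsec v hv]
          split_ifs with hvu
          · rfl
          · exact hs v hv (by simp [hvu, hvs]))
      simpa using mul_mem hm this
    · refine ih hg hdvd fun v hv hvs => hs v hv ?_
      rw [mem_insert, not_or]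
      exact ⟨fun e => hu (e ▸ hv), hvs⟩

/-- The rigid level stabilizer consists of the elements of the level stabilizer whose sections have
total exponents divisible by `2 ^ (k + 1)`. -/
theorem mem_levelRist_iff (hd : 3 ≤ d) (hodd : Odd d) {k : ℕ} (hk : 1 ≤ k)
    {g : Perm (List (Fin d))} (hg : g ∈ levelStab (G d) k) :
    g ∈ levelRist (G d) k ↔
      ∀ u : List (Fin d), u.length = k → 2 ^ (k + 1) ∣ ex (sec g u) := by
  have hle := levelRist_le_levelStab (G_le_autTree d) k
  constructor
  · intro h
    clear hg
    induction h using Subgroup.closure_induction with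
    | mem g hg =>
      obtain ⟨v, hv, hg⟩ := hg
      intro u hu
      have he := eq_atVertex_of_mem_rist hd hg
      by_cases huv : u = v
      · subst huv
        rw [← hu]
        refine dvd_ex_of_atVertex_mem hd hodd ?_ (he ▸ hg.1)
        rintro rfl
        simp at hu
        omega
      · rw [he, sec_atVertex_of_ne _ (hu.trans hv.symm) huv, ex_one hd]
        exact dvd_zero _
    | one => intro u _; simp [ex_one hd]
    | mul a b ha hb iha ihb =>
      intro u hu
      rw [ex_sec_mul hd (hle ha) (hle hb) hu.le]
      exact dvd_add (iha u hu) (ihb u hu)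
    | inv a ha iha =>
      intro u hu
      rw [sec_inv hd (hle ha) hu.le, ex_inv hd (sec_mem hd (hle ha).1 u)]
      exact (iha u hu).neg_right
  · intro h
    exact mem_levelRist_of_dvd hd hodd (List.finite_length_eq (Fin d) k).toFinset hg h
      fun u hu hn => absurd (by simpa using hu) hn

/-! ### Total exponents of the sections of an element of the level stabilizer -/

theorem dvd_ex_sec_iff (hd : 3 ≤ d) {k : ℕ} (hk : 1 ≤ k) {x₀ : Fin d}
    {g : Perm (List (Fin d))} (hg : g ∈ levelStab (G d) k) :
    (∀ (p : List (Fin d)) (x : Fin d), x ≠ x₀ → p.length + 1 ≤ k →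
        2 ^ (p.length + 2) ∣ ex (sec g (p ++ [x]))) ↔
      ∀ u : List (Fin d), u.length = k → 2 ^ (k + 1) ∣ ex (sec g u) := by
  constructor
  · intro h
    have key : ∀ u : List (Fin d), u.length ≤ k → 2 ^ (u.length + 1) ∣ ex (sec g u) := by
      intro u
      induction u using List.reverseRecOn with
      | nil =>
        intro _
        simpa using (even_ex_sec hd hg (u := []) (Nat.lt_of_lt_of_le Nat.zero_lt_one hk)).two_dvd
      | append_singleton p x ih =>
        intro hp
        simp only [List.length_append, List.length_singleton] at hp ⊢
        by_cases hx : x = x₀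
        · subst hx
          have h1 := sum_ex_sec hd hg.1 p
          rw [← add_sum_erase _ _ (mem_univ x), ← eq_sub_iff_add_eq] at h1
          rw [h1]
          refine dvd_sub ?_ (dvd_sum fun y hy => h p y (ne_of_mem_erase hy) hp)
          rw [pow_succ']
          exact mul_dvd_mul_left _ (ih (by omega))
        · exact h p x hx hp
    intro u hu
    have := key u hu.le
    rwa [hu] at this
  · intro h
    have key : ∀ j, ∀ u : List (Fin d), u.length + j = k → 2 ^ (u.length + 1) ∣ ex (sec g u) := by
      intro j
      induction j with
      | zero =>
        intro u hu
        rw [add_zero] at hu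
        rw [hu]
        exact h u hu
      | succ j ih =>
        intro u hu
        have h1 : (2 : ℤ) ^ (u.length + 1 + 1) ∣ 2 * ex (sec g u) := by
          rw [← sum_ex_sec hd hg.1 u]
          refine dvd_sum fun x _ => ?_
          simpa using ih (u ++ [x]) (by simp; omega)
        rw [pow_succ'] at h1
        exact (mul_dvd_mul_iff_left two_ne_zero).1 h1
    intro p x _ hp
    simpa using key (k - (p.length + 1)) (p ++ [x]) (by simp; omega)

/-- Every choice of half the total exponent at the root and at the vertices above level `k` whose last
letter is not `x₀`, and of the total exponent at such vertices of level `k`, is realized. -/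
theorem exists_ex_sec_eq (hd : 3 ≤ d) (hodd : Odd d) (x₀ : Fin d) (k : ℕ) (n : ℤ)
    (c : List (Fin d) → ℤ) :
    ∃ g ∈ levelStab (G d) k, ex g = (if k = 0 then n else 2 * n) ∧
      ∀ (p : List (Fin d)) (x : Fin d), x ≠ x₀ → p.length + 1 ≤ k →
        ex (sec g (p ++ [x])) =
          if k = p.length + 1 then c (p ++ [x]) else 2 * c (p ++ [x]) := by
  induction k generalizing n c with
  | zero =>
    obtain ⟨g, hg, h⟩ := exists_ex_eq hd n
    exact ⟨g, mem_levelStab_zero hg, by simpa using h, fun p x _ hp => by omega⟩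
  | succ k ih =>
    set m : Fin d → ℤ := fun x =>
      if x = x₀ then (if k = 0 then 4 * n else 2 * n) - ∑ y ∈ univ.erase x₀, c [y] else c [x]
      with hm
    have hsum : ∑ x, m x = if k = 0 then 4 * n else 2 * n := by
      rw [← add_sum_erase _ _ (mem_univ x₀), sum_congr rfl fun y hy => show m y = c [y] from
        if_neg (ne_of_mem_erase hy)]
      simp [hm]
    choose f hf hfex hfsec using fun x => ih (m x) fun p => c (x :: p)
    have hfsum : ∑ x, ex (f x) = 4 * n := by
      simp only [hfex]
      split_ifs at hsum ⊢
      · exact hsum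
      · rw [← mul_sum, hsum]
        ring
    have hG : node 1 f ∈ G d := (node_one_mem_G_iff hd hodd fun x => (hf x).1).2 ⟨n, hfsum⟩
    refine ⟨node 1 f, (mem_levelStab_succ hd hG).2 ⟨root_node _ _, fun x => ?_⟩, ?_, ?_⟩
    · rw [sec1_node]
      exact hf x
    · have := sum_ex_sec1 hd hG
      rw [sec1_node, hfsum] at this
      rw [if_neg k.succ_ne_zero]
      omega
    · intro p x hx hp
      cases p with
      | nil => simp [hfex, hm, hx]
      | cons y p =>
        have := hfsec y p x hx (by simpa using hp)
        simpa using this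

/-! ### Vertices and their numbers -/

theorem multiplicity_pow_mul (hd : 3 ≤ d) (s : ℕ) {r : ℕ} (hr : ¬ d ∣ r) :
    multiplicity d (d ^ s * r) = s := by
  apply multiplicity_eq_of_dvd_of_not_dvd (dvd_mul_right _ _)
  rw [pow_succ]
  exact fun h => hr (Nat.dvd_of_mul_dvd_mul_left (by positivity) h)

theorem exists_eq_pow_mul_of_mem_Icc (hd : 3 ≤ d) {k i : ℕ} (hi : i ∈ Icc 1 (d ^ k - 1)) :
    ∃ j m r, k = m + 1 + j ∧ i = d ^ j * r ∧ ¬ d ∣ r ∧ r < d ^ (m + 1) := by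
  rw [mem_Icc] at hi
  obtain ⟨j, r, hr, rfl⟩ := Nat.exists_eq_pow_mul_and_not_dvd (n := i) (by omega) d (by omega)
  have hr0 : 0 < r := Nat.pos_of_ne_zero fun h => hr (h ▸ dvd_zero d)
  have hlt : d ^ j * r < d ^ k := by
    have : 0 < d ^ k := by positivity
    omega
  have hjk : j < k := by
    rw [← Nat.pow_lt_pow_iff_right (a := d) (by omega)]
    exact (Nat.le_mul_of_pos_right _ hr0).trans_lt hlt
  obtain ⟨m, rfl⟩ := Nat.exists_eq_add_of_lt hjk
  refine ⟨j, m, r, by omega, rfl, hr, ?_⟩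
  rw [add_assoc, pow_add] at hlt
  exact Nat.lt_of_mul_lt_mul_left hlt

/-- The last `n` digits of a number in base `d`, the most significant digit first. -/
def digitWord (hd : 3 ≤ d) : ℕ → ℕ → List (Fin d)
  | 0, _ => []
  | n + 1, i => digitWord hd n (i / d) ++ [⟨i % d, Nat.mod_lt _ (by omega)⟩]

theorem length_digitWord (hd : 3 ≤ d) (n i : ℕ) : (digitWord hd n i).length = n := by
  induction n generalizing i with
  | zero => rfl
  | succ n ih => simp [digitWord, ih]

theorem digitWord_injOn (hd : 3 ≤ d) {n i j : ℕ} (hi : i < d ^ n) (hj : j < d ^ n)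
    (h : digitWord hd n i = digitWord hd n j) : i = j := by
  induction n generalizing i j with
  | zero =>
    rw [pow_zero] at hi hj
    omega
  | succ n ih =>
    rw [pow_succ] at hi hj
    obtain ⟨h1, h2⟩ := List.append_inj' h rfl
    have h3 := ih (Nat.div_lt_of_lt_mul (by rwa [mul_comm]))
      (Nat.div_lt_of_lt_mul (by rwa [mul_comm])) h1
    have h4 : i % d = j % d := by simpa using h2
    rw [← Nat.div_add_mod i d, h3, h4, Nat.div_add_mod]

theorem exists_digitWord_eq (hd : 3 ≤ d) (u : List (Fin d)) :
    ∃ i, i < d ^ u.length ∧ digitWord hd u.length i = u := by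
  induction u using List.reverseRecOn with
  | nil => exact ⟨0, by simp, rfl⟩
  | append_singleton p x ih =>
    obtain ⟨i, hi, h⟩ := ih
    refine ⟨d * i + x, ?_, ?_⟩
    · have := x.2
      rw [List.length_append, List.length_singleton, pow_succ]
      nlinarith
    · have hx := Nat.mod_eq_of_lt x.2
      simp [digitWord, Nat.mul_add_div (show 0 < d by omega), Nat.div_eq_of_lt x.2, h, hx]

/-- The vertex that corresponds to a factor of `St(k) / Rist(k)`. -/
noncomputable def vertex (hd : 3 ≤ d) (k i : ℕ) : List (Fin d) :=
  digitWord hd (k - multiplicity d i) (i / d ^ multiplicity d i)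

theorem vertex_pow_mul (hd : 3 ≤ d) {j m r : ℕ} (hr : ¬ d ∣ r) :
    vertex hd (m + 1 + j) (d ^ j * r) = digitWord hd (m + 1) r := by
  rw [vertex, multiplicity_pow_mul hd j hr, Nat.add_sub_cancel,
    Nat.mul_div_cancel_left _ (by positivity)]

theorem exists_vertex_eq (hd : 3 ≤ d) {k i : ℕ} (hi : i ∈ Icc 1 (d ^ k - 1)) :
    ∃ (p : List (Fin d)) (x : Fin d), x ≠ ⟨0, by omega⟩ ∧ p.length + 1 ≤ k ∧
      vertex hd k i = p ++ [x] ∧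
      alpha d k i = if p.length + 1 = k then 2 ^ (k + 1) else 2 ^ (p.length + 1) := by
  obtain ⟨j, m, r, rfl, rfl, hr, -⟩ := exists_eq_pow_mul_of_mem_Icc hd hi
  refine ⟨digitWord hd m (r / d), ⟨r % d, Nat.mod_lt _ (by omega)⟩, ?_, ?_, ?_, ?_⟩
  · rw [Ne, Fin.mk.injEq]
    exact fun h => hr (Nat.dvd_of_mod_eq_zero h)
  · rw [length_digitWord]
    omega
  · rw [vertex_pow_mul hd hr]
    rfl
  · rw [length_digitWord]
    rcases Nat.eq_zero_or_pos j with rfl | hj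
    · rw [if_pos rfl, alpha_eq_of_not_dvd (by simpa using hr)]
    · rw [if_neg (by omega), alpha_eq_of_eq (by omega) hj hr, Nat.add_sub_cancel]

theorem exists_vertex_eq_append (hd : 3 ≤ d) {k : ℕ} {p : List (Fin d)} {x : Fin d}
    (hx : x ≠ ⟨0, by omega⟩) (hp : p.length + 1 ≤ k) :
    ∃ i ∈ Icc 1 (d ^ k - 1), vertex hd k i = p ++ [x] := by
  obtain ⟨r, hr, hrp⟩ := exists_digitWord_eq hd (p ++ [x])
  rw [List.length_append, List.length_singleton] at hr hrp
  obtain ⟨j, rfl⟩ := Nat.exists_eq_add_of_le hp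
  have hdvd : ¬ d ∣ r := fun h => hx (by
    have := (List.append_inj' hrp rfl).2
    simp only [List.cons.injEq, and_true] at this
    rw [← this, Fin.mk.injEq]
    exact Nat.mod_eq_zero_of_dvd h)
  have hr0 : 0 < r := Nat.pos_of_ne_zero fun h => hdvd (h ▸ dvd_zero d)
  have h1 : 0 < d ^ j := by positivity
  refine ⟨d ^ j * r, ?_, by rw [vertex_pow_mul hd hdvd, hrp]⟩
  have h2 : d ^ j * r < d ^ (p.length + 1 + j) := by
    rw [pow_add, mul_comm]
    exact Nat.mul_lt_mul_of_pos_right hr h1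
  have h3 : 0 < d ^ j * r := by positivity
  rw [mem_Icc]
  omega

theorem vertex_injOn (hd : 3 ≤ d) (k : ℕ) :
    Set.InjOn (vertex hd k) (Icc 1 (d ^ k - 1) : Finset ℕ) := by
  intro i hi i' hi' h
  obtain ⟨j, m, r, hk, rfl, hr, hlt⟩ := exists_eq_pow_mul_of_mem_Icc hd hi
  obtain ⟨j', m', r', hk', rfl, hr', hlt'⟩ := exists_eq_pow_mul_of_mem_Icc hd hi'
  nth_rw 1 [hk] at h
  rw [hk', vertex_pow_mul hd hr, vertex_pow_mul hd hr'] at h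
  have hm : m = m' := by simpa [length_digitWord] using congrArg List.length h
  subst hm
  have hj : j = j' := by omega
  subst hj
  rw [digitWord_injOn hd hlt hlt' h]

/-! ### The isomorphism -/

/-- The total exponent of the section at a vertex of level `k`, and half the total exponent of the
section at a vertex above. -/
noncomputable def coord (k : ℕ) (u : List (Fin d)) (g : Perm (List (Fin d))) : ℤ :=
  if u.length = k then ex (sec g u) else ex (sec g u) / 2

theorem coord_mul (hd : 3 ≤ d) {k : ℕ} {g h : Perm (List (Fin d))}
    (hg : g ∈ levelStab (G d) k) (hh : h ∈ levelStab (G d) k) {u : List (Fin d)}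
    (hu : u.length ≤ k) : coord k u (g * h) = coord k u g + coord k u h := by
  rw [coord, coord, coord, ex_sec_mul hd hg hh hu]
  split_ifs with hk
  · rfl
  · exact Int.add_ediv_of_dvd_left (even_ex_sec hd hg (lt_of_le_of_ne hu hk)).two_dvd

theorem length_vertex_le (hd : 3 ≤ d) (k i : ℕ) : (vertex hd k i).length ≤ k := by
  rw [vertex, length_digitWord]
  exact Nat.sub_le _ _

/-- The homomorphism from the level stabilizer with kernel the rigid level stabilizer. -/
noncomputable def coordHom (hd : 3 ≤ d) (k : ℕ) : levelStab (G d) k →*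
    ((i : Icc 1 (d ^ k - 1)) → Multiplicative (ZMod (alpha d k i))) :=
  MonoidHom.mk' (fun g i => Multiplicative.ofAdd (coord k (vertex hd k i) g.1 : ZMod _))
    fun g h => by
      ext1 i
      rw [Pi.mul_apply, ← ofAdd_add, ← Int.cast_add,
        ← coord_mul hd g.2 h.2 (length_vertex_le hd k i)]
      rfl

theorem alpha_dvd_coord_iff (hd : 3 ≤ d) {k : ℕ} {g : Perm (List (Fin d))}
    (hg : g ∈ levelStab (G d) k) {i : ℕ} (hi : i ∈ Icc 1 (d ^ k - 1)) :
    (alpha d k i : ℤ) ∣ coord k (vertex hd k i) g ↔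
      2 ^ ((vertex hd k i).length + 1) ∣ ex (sec g (vertex hd k i)) := by
  obtain ⟨p, x, -, hp, hv, hα⟩ := exists_vertex_eq hd hi
  rw [hv, hα, coord, List.length_append, List.length_singleton]
  split_ifs with hk
  · rw [hk]
    push_cast
    rfl
  · obtain ⟨c, hc⟩ := (even_ex_sec hd hg (u := p ++ [x])
      (by simp only [List.length_append, List.length_singleton]; omega)).two_dvd
    rw [hc, Int.mul_ediv_cancel_left _ two_ne_zero, pow_succ' _ (p.length + 1),
      mul_dvd_mul_iff_left two_ne_zero]
    push_cast
    rfl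

theorem ker_coordHom (hd : 3 ≤ d) (hodd : Odd d) {k : ℕ} (hk : 1 ≤ k) :
    (coordHom hd k).ker = (levelRist (G d) k).subgroupOf (levelStab (G d) k) := by
  ext ⟨g, hg⟩
  rw [Subgroup.mem_subgroupOf, mem_levelRist_iff hd hodd hk hg,
    ← dvd_ex_sec_iff hd hk (x₀ := ⟨0, by omega⟩) hg, MonoidHom.mem_ker, funext_iff]
  have key : ∀ i : Icc 1 (d ^ k - 1), coordHom hd k ⟨g, hg⟩ i = 1 ↔
      2 ^ ((vertex hd k i).length + 1) ∣ ex (sec g (vertex hd k i)) := fun i => by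
    rw [← alpha_dvd_coord_iff hd hg i.2, ← ZMod.intCast_zmod_eq_zero_iff_dvd]
    exact Iff.rfl
  constructor
  · intro h p x hx hp
    obtain ⟨i, hi, hv⟩ := exists_vertex_eq_append hd hx hp
    simpa [hv] using (key ⟨i, hi⟩).1 (h ⟨i, hi⟩)
  · intro h i
    obtain ⟨p, x, hx, hp, hv, -⟩ := exists_vertex_eq hd i.2
    exact (key i).2 (by simpa [hv] using h p x hx hp)

theorem coordHom_surjective (hd : 3 ≤ d) (hodd : Odd d) (k : ℕ) :
    Function.Surjective (coordHom hd k) := by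
  intro t
  choose a ha using fun i => ZMod.intCast_surjective (Multiplicative.toAdd (t i))
  have hinj : Function.Injective fun i : Icc 1 (d ^ k - 1) => vertex hd k i :=
    fun i j h => Subtype.ext (vertex_injOn hd k i.2 j.2 h)
  obtain ⟨g, hg, -, h⟩ := exists_ex_sec_eq hd hodd ⟨0, by omega⟩ k 0
    (Function.extend (fun i : Icc 1 (d ^ k - 1) => vertex hd k i) a 0)
  refine ⟨⟨g, hg⟩, funext fun i => ?_⟩
  have hc : coord k (vertex hd k i) g = a i := by
    obtain ⟨p, x, hx, hp, hv, -⟩ := exists_vertex_eq hd i.2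
    have hext := hinj.extend_apply a 0 i
    rw [coord, hv, h p x hx hp, ← hv, hext, hv, List.length_append, List.length_singleton]
    by_cases hpk : k = p.length + 1
    · rw [if_pos hpk.symm, if_pos hpk]
    · rw [if_neg (Ne.symm hpk), if_neg hpk, Int.mul_ediv_cancel_left _ two_ne_zero]
  change Multiplicative.ofAdd ((coord k (vertex hd k i) g : ℤ) : ZMod _) = t i
  rw [hc, ha]
  rfl

/-! ### The index -/

theorem sum_Ico_mul (hd : 3 ≤ d) {N c : ℕ} (hN : 1 ≤ N) {F : ℕ → ℕ}
    (hF : ∀ i, ¬ d ∣ i → F i = c) :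
    ∑ i ∈ Ico 1 (d * N), F i = (d * N - N) * c + ∑ j ∈ Ico 1 N, F (d * j) := by
  have himg : (Ico 1 (d * N)).filter (d ∣ ·) = (Ico 1 N).image (d * ·) := by
    ext i
    simp only [mem_filter, mem_Ico, mem_image]
    constructor
    · rintro ⟨⟨h1, h2⟩, j, rfl⟩
      exact ⟨j, ⟨Nat.pos_of_ne_zero (by rintro rfl; simp at h1), Nat.lt_of_mul_lt_mul_left h2⟩, rfl⟩
    · rintro ⟨j, ⟨h1, h2⟩, rfl⟩
      exact ⟨⟨Nat.mul_pos (by omega) h1, Nat.mul_lt_mul_of_pos_left h2 (by omega)⟩,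
        dvd_mul_right _ _⟩
  have hinj : Function.Injective (d * ·) := fun _ _ h =>
    Nat.eq_of_mul_eq_mul_left (by omega) h
  have hcard := card_filter_add_card_filter_not (s := Ico 1 (d * N)) (d ∣ ·)
  rw [himg, card_image_of_injective _ hinj, Nat.card_Ico, Nat.card_Ico] at hcard
  rw [← sum_filter_not_add_sum_filter _ (d ∣ ·), himg, sum_image hinj.injOn,
    sum_congr rfl fun i hi => hF i (mem_filter.1 hi).2, sum_const, smul_eq_mul]
  congr 2
  have : N ≤ d * N := Nat.le_mul_of_pos_left _ (by omega)
  omega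

theorem multiplicity_mul_self (hd : 3 ≤ d) {j : ℕ} (hj : j ≠ 0) :
    multiplicity d (d * j) = multiplicity d j + 1 := by
  obtain ⟨s, r, hr, rfl⟩ := Nat.exists_eq_pow_mul_and_not_dvd hj d (by omega)
  rw [multiplicity_pow_mul hd s hr, ← mul_assoc, ← pow_succ', multiplicity_pow_mul hd _ hr]

theorem sum_sub_multiplicity (hd : 3 ≤ d) (k : ℕ) :
    ((∑ i ∈ Ico 1 (d ^ k), (k - multiplicity d i) : ℕ) : ℚ) * (d - 1) =
      k * d ^ (k + 1) - (k + 1) * d ^ k + 1 := by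
  induction k with
  | zero => simp
  | succ k ih =>
    have h1 : 1 ≤ d ^ k := Nat.one_le_pow _ _ (by omega)
    have h2 : d ^ k ≤ d * d ^ k := Nat.le_mul_of_pos_left _ (by omega)
    rw [pow_succ', sum_Ico_mul hd h1 (c := k + 1)
      fun i hi => by rw [multiplicity_eq_zero.2 hi, Nat.sub_zero]]
    rw [sum_congr rfl fun j hj => show k + 1 - multiplicity d (d * j) = k - multiplicity d j by
      rw [multiplicity_mul_self hd (by rw [mem_Ico] at hj; omega), Nat.add_sub_add_right]]
    rw [Nat.cast_add, add_mul, ih]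
    push_cast [h2]
    ring

/-- The exponent of two in `alpha d k i`. -/
noncomputable def alphaLog (d k i : ℕ) : ℕ := if d ∣ i then k - multiplicity d i else k + 1

theorem sum_alphaLog (hd : 3 ≤ d) (k : ℕ) :
    ((∑ i ∈ Ico 1 (d ^ (k + 1)), alphaLog d (k + 1) i : ℕ) : ℚ) * (d - 1) =
      (k + 2) * d ^ (k + 2) - (k + 4) * d ^ (k + 1) + d ^ k + 1 := by
  have h1 : 1 ≤ d ^ k := Nat.one_le_pow _ _ (by omega)
  have h2 : d ^ k ≤ d * d ^ k := Nat.le_mul_of_pos_left _ (by omega)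
  rw [pow_succ', sum_Ico_mul hd h1 (c := k + 2) fun i hi => by rw [alphaLog, if_neg hi]]
  rw [sum_congr rfl fun j hj => show alphaLog d (k + 1) (d * j) = k - multiplicity d j by
    rw [alphaLog, if_pos (dvd_mul_right _ _),
      multiplicity_mul_self hd (by rw [mem_Ico] at hj; omega), Nat.add_sub_add_right]]
  rw [Nat.cast_add, add_mul, sum_sub_multiplicity hd]
  push_cast [h2]
  ring

theorem prod_alpha (d k : ℕ) :
    ∏ i : Icc 1 (d ^ k - 1), alpha d k i = 2 ^ ∑ i ∈ Icc 1 (d ^ k - 1), alphaLog d k i := by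
  rw [prod_coe_sort (Icc 1 (d ^ k - 1)) (alpha d k), ← prod_pow_eq_pow_sum]
  refine prod_congr rfl fun i _ => ?_
  rw [alpha, alphaLog]
  split_ifs <;> rfl

end GdGroup

theorem mainTheorem4 (d : ℕ) (hd : 3 ≤ d) (hodd : Odd d) (k : ℕ) (hk : 1 ≤ k) :
    Nonempty
      ((GdGroup.levelStab (GdGroup.G d) k ⧸
          (GdGroup.levelRist (GdGroup.G d) k).subgroupOf (GdGroup.levelStab (GdGroup.G d) k)) ≃*
        ((i : Finset.Icc 1 (d ^ k - 1)) → Multiplicative (ZMod (GdGroup.alpha d k i)))) ∧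
    ∃ t : ℕ,
      (t : ℚ) = (((k : ℚ) + 1) * (d : ℚ) ^ (k + 1) - ((k : ℚ) + 3) * (d : ℚ) ^ k
          + (d : ℚ) ^ (k - 1) + 1) / ((d : ℚ) - 1) ∧
      (GdGroup.levelRist (GdGroup.G d) k).relIndex (GdGroup.levelStab (GdGroup.G d) k) = 2 ^ t := by
  let e := (QuotientGroup.quotientMulEquivOfEq (GdGroup.ker_coordHom hd hodd hk).symm).trans
    (QuotientGroup.quotientKerEquivOfSurjective _ (GdGroup.coordHom_surjective hd hodd k))
  refine ⟨⟨e⟩, ∑ i ∈ Finset.Icc 1 (d ^ k - 1), GdGroup.alphaLog d k i, ?_, ?_⟩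
  · obtain ⟨k, rfl⟩ := Nat.exists_eq_add_of_le' hk
    have hd1 : (d : ℚ) - 1 ≠ 0 := by
      have : (3 : ℚ) ≤ d := by exact_mod_cast hd
      linarith
    have hIcc : Finset.Icc 1 (d ^ (k + 1) - 1) = Finset.Ico 1 (d ^ (k + 1)) := by
      have : 0 < d ^ (k + 1) := by positivity
      ext i
      rw [Finset.mem_Icc, Finset.mem_Ico]
      omega
    rw [eq_div_iff hd1, hIcc, GdGroup.sum_alphaLog hd, Nat.add_sub_cancel]
    push_cast
    ring
  · rw [← GdGroup.prod_alpha, Subgroup.relIndex, Subgroup.index, Nat.card_congr e.toEquiv,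
      Nat.card_pi]
    exact Finset.prod_congr rfl fun i _ => Nat.card_zmod _
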